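/- Let $W_2$ denote the Wasserstein-2 distance for the Euclidean norm (with values in $[0,\infty]$), $\mathcal P_2(E)$ the Borel probability measures on $E$ with finite second moment, and for a Markov kernel $\mu(\cdot,x)$ and a probability measure $\nu$ let $\mu(\cdot,x)\times_x\nu$ be the joint law of $(x,y)$ obtained by drawing $x\sim\nu$ and then $y\sim\mu(\cdot,x)$. Let $K,\epsilon\ge 0$. (a) Let $P_{X_0,X_1}\in\mathcal P_2(\mathbb R^m\times\mathbb R^d)$, $P_{Y_0}\in\mathcal P_2(\mathbb R^m)$, let $\mu(\cdot,a)$, $a\in\mathbb R^m$, be a Markov kernel to $\mathbb R^d$, and put $\alpha:=\mu(\cdot,x_0)\times_{x_0}P_{Y_0}$. Assume (i) $\int W_2^2(P_{X_1|X_0=a},\mu(\cdot,a))\,dP_{X_0}(a)\le\epsilon$; (ii) $W_2(P_{X_1|X_0=a},P_{X_1|X_0=b})\le K\|a-b\|$ for $P_{X_0}$-a.e. $a$ and $P_{X_0}$-a.e. $b$; (iii) $W_2(\mu(\cdot,a),\mu(\cdot,b))\le K\|a-b\|$ for all $a,b\in\mathbb R^m$. Then $\alpha\in\mathcal P_2(\mathbb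 R^m\times\mathbb R^d)$ and $$W_2^2(P_{X_0,X_1},\alpha)\le(1+20K^2)\,W_2^2(P_{X_0},P_{Y_0})+4\epsilon.$$ (b) Let $n\ge 0$, let $X_0,\dots,X_n,Y_0$ be square-integrable $\mathbb R^d$-valued random variables on a probability space, let $\mu_i(\cdot,x_0,\dots,x_i)$, $0\le i<n$, be Markov kernels from $(\mathbb R^d)^{i+1}$ to $\mathbb R^d$, and let $$\mu:=\mu_{n-1}(\cdot,x_0,\dots,x_{n-1})\times_{x_0,\dots,x_{n-1}}\cdots\times_{x_1,x_0}\mu_0(\cdot,x_0)\times_{x_0}P_{Y_0},$$ a probability measure on $(\mathbb R^d)^{n+1}$. Write $P_{X_{i+1}|a}$ for $P_{X_{i+1}|X_0=a_0,\dots,X_i=a_i}$, where $a=(a_0,\dots,a_i)$. Assume for every $0\le i<n$ (i) $\int W_2^2(P_{X_{i+1}|a},\mu_i(\cdot,a))\,dP_{X_0,\dots,X_i}(a)\le\epsilon$; (ii) $W_2(P_{X_{i+1}|a},P_{X_{i+1}|b})\le K\|a-b\|$ for $P_{X_0,\dots,X_i}$-a.e. $a$ and $P_{X_0,\dots,X_i}$-a.e.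 $b$; (iii) $W_2(\mu_i(\cdot,a),\mu_i(\cdot,b))\le K\|a-b\|$ for all $a,b\in(\mathbb R^d)^{i+1}$. Then $\mu\in\mathcal P_2((\mathbb R^d)^{n+1})$ and $$W_2^2(P_{X_0,\dots,X_n},\mu)\le 4\epsilon\sum_{i=0}^{n-1}(1+20K^2)^i+(1+20K^2)^n\,W_2^2(P_{X_0},P_{Y_0}).$$ -/

import Mathlib

open MeasureTheory ProbabilityTheory
open scoped ENNReal NNReal

noncomputable section

/-- The Euclidean space `ℝᵈ`. -/
abbrev Rn (d : ℕ) : Type := EuclideanSpace ℝ (Fin d)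

/-- `(ℝᵈ)ᵏ` with its Euclidean norm `‖(x_0, …, x_{k-1})‖² = ∑ ‖x_j‖²`, i.e. `ℝ^{kd}`. -/
abbrev RnPow (d k : ℕ) : Type := PiLp 2 (fun _ : Fin k => Rn d)

/-- The couplings of `μ` and `ν`: measures on the product with marginals `μ` and `ν`. -/
def couplings {E : Type*} [MeasurableSpace E] (μ ν : Measure E) : Set (Measure (E × E)) :=
  {π | π.map Prod.fst = μ ∧ π.map Prod.snd = ν}

/-- The Wasserstein-2 distance
`W₂(μ, ν) = (inf over couplings π of ∫ dist(x, y)² dπ(x, y))^{1/2}`, with values in `[0, ∞]`. -/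
def W2 {E : Type*} [PseudoEMetricSpace E] [MeasurableSpace E] (μ ν : Measure E) : ℝ≥0∞ :=
  (⨅ π ∈ couplings μ ν, ∫⁻ p, edist p.1 p.2 ^ 2 ∂π) ^ (1 / 2 : ℝ)

/-- `μ ∈ 𝒫₂(E)`: a probability measure with finite second moment. -/
def IsP2 {E : Type*} [NormedAddCommGroup E] [MeasurableSpace E] (μ : Measure E) : Prop :=
  IsProbabilityMeasure μ ∧ ∫⁻ x, ‖x‖ₑ ^ 2 ∂μ < ∞

/-- A measure on `ℝᵐ × ℝᵈ`, carried over to the same product equipped with the Euclidean norm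
`‖(a, x)‖² = ‖a‖² + ‖x‖²` (Mathlib's bare product type carries the maximum norm). -/
def toEuclid {m d : ℕ} (ρ : Measure (Rn m × Rn d)) : Measure (WithLp 2 (Rn m × Rn d)) :=
  ρ.map (WithLp.toLp 2)

/-- The random vector `(X_0, …, X_{k-1})`, for a sequence of `ℝᵈ`-valued random variables. -/
def initSeg {Ω : Type*} {d : ℕ} (X : ℕ → Ω → Rn d) (k : ℕ) (ω : Ω) : RnPow d k :=
  WithLp.toLp 2 fun j : Fin k => X j ω

/-- The vector `(x_0, …, x_{k-1}, y)`. -/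
def appendLast {d k : ℕ} (p : RnPow d k × Rn d) : RnPow d (k + 1) :=
  WithLp.toLp 2 (Fin.snoc (α := fun _ => Rn d) (fun j : Fin k => p.1 j) p.2)

/-- The glued law `μ_{n-1}(·, x_0, …, x_{n-1}) ×_{x_0, …, x_{n-1}} ⋯ ×_{x_0} ν` on `(ℝᵈ)^{n+1}`:
draw `x_0 ∼ ν`, then successively `x_{i+1} ∼ μ_i(·, x_0, …, x_i)` for `i < n`. -/
def glue {d : ℕ} (ν : Measure (Rn d)) (μ : (i : ℕ) → Kernel (RnPow d (i + 1)) (Rn d)) :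
    (n : ℕ) → Measure (RnPow d (n + 1))
  | 0 => ν.map fun x => WithLp.toLp 2 fun _ : Fin 1 => x
  | n + 1 => (glue ν μ n ⊗ₘ μ n).map appendLast

end

/-! Write `κ a` for the conditional law of the next variable given `a`, and `θ`, `ν` for the two
initial laws. Take any coupling `π` of `θ` and `ν`, and above each pair `(a, b)` put a nearly
optimal coupling of `κ a` and `μ b`. The result couples the two joint laws at cost `∫ ‖a - b‖² + W2
(κ a) (μ b) ^ 2 dπ`, up to a small error. Passing through `μ a` gives `W2 (κ a) (μ b) ^ 2 ≤ 2 W2 (κ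
a) (μ a) ^ 2 + 2 K² ‖a - b‖²`, whose first term integrates to at most `2ε`. This is
`W2_sq_map_compProd_le`; the case of several time points iterates it.

The real difficulty is to choose the couplings measurably in `(a, b)`
(`exists_near_optimal_kernel`). The solution is a countable list of densities, fixed once for all
pairs of measures. Each is completed canonically to a coupling of any given pair, and for measures
with finite second moment the infimum of the resulting costs is `W2 ^ 2`
(`exists_densities_iInf_cost_eq`). The completion depends measurably on the pair, so the first
nearly optimal index does too. -/

theorem ENNReal.add_sq_le_two_mul (a b : ℝ≥0∞) : (a + b) ^ 2 ≤ 2 * a ^ 2 + 2 * b ^ 2 := by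
  rcases eq_or_ne a ∞ with rfl | ha
  · simp
  rcases eq_or_ne b ∞ with rfl | hb
  · simp
  lift a to ℝ≥0 using ha
  lift b to ℝ≥0 using hb
  have := add_sq_le (a := a) (b := b)
  rw [mul_add] at this
  exact_mod_cast this

theorem edist_sq_le_two_mul {E : Type*} [PseudoEMetricSpace E] (x y z : E) :
    edist x z ^ 2 ≤ 2 * edist x y ^ 2 + 2 * edist y z ^ 2 :=
  (pow_le_pow_left₀ zero_le (edist_triangle x y z) 2).trans (ENNReal.add_sq_le_two_mul _ _)

theorem enorm_sq_le_two_mul {E : Type*} [SeminormedAddCommGroup E] (x y : E) :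
    ‖y‖ₑ ^ 2 ≤ 2 * ‖x‖ₑ ^ 2 + 2 * edist x y ^ 2 := by
  have := edist_sq_le_two_mul 0 x y
  simpa [edist_eq_enorm_sub] using this

theorem edist_sq_le_enorm {E : Type*} [SeminormedAddCommGroup E] (x y : E) :
    edist x y ^ 2 ≤ 2 * ‖x‖ₑ ^ 2 + 2 * ‖y‖ₑ ^ 2 := by
  have := edist_sq_le_two_mul x 0 y
  simpa [edist_eq_enorm_sub] using this

/-! ### Couplings and the squared Wasserstein distance -/

section Basic

variable {E : Type*} [MeasurableSpace E]

theorem isProbabilityMeasure_of_mem_couplings {μ ν : Measure E} [IsProbabilityMeasure μ]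
    {π : Measure (E × E)} (hπ : π ∈ couplings μ ν) : IsProbabilityMeasure π := by
  constructor
  have : (π.map Prod.fst) Set.univ = 1 := by rw [hπ.1]; simp
  rwa [Measure.map_apply measurable_fst MeasurableSet.univ, Set.preimage_univ] at this

theorem lintegral_fst_of_mem_couplings {μ ν : Measure E} {π : Measure (E × E)}
    (hπ : π ∈ couplings μ ν) {f : E → ℝ≥0∞} (hf : AEMeasurable f μ) :
    ∫⁻ p, f p.1 ∂π = ∫⁻ x, f x ∂μ := by
  obtain ⟨rfl, -⟩ := hπ
  rw [lintegral_map' hf measurable_fst.aemeasurable]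

theorem lintegral_snd_of_mem_couplings {μ ν : Measure E} {π : Measure (E × E)}
    (hπ : π ∈ couplings μ ν) {f : E → ℝ≥0∞} (hf : AEMeasurable f ν) :
    ∫⁻ p, f p.2 ∂π = ∫⁻ x, f x ∂ν := by
  obtain ⟨-, rfl⟩ := hπ
  rw [lintegral_map' hf measurable_snd.aemeasurable]

theorem swap_mem_couplings {μ ν : Measure E} {π : Measure (E × E)} (hπ : π ∈ couplings μ ν) :
    π.map Prod.swap ∈ couplings ν μ := by
  constructor
  · rw [Measure.map_map measurable_fst measurable_swap]; exact hπ.2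
  · rw [Measure.map_map measurable_snd measurable_swap]; exact hπ.1

theorem W2_sq [PseudoEMetricSpace E] (μ ν : Measure E) :
    W2 μ ν ^ 2 = ⨅ π ∈ couplings μ ν, ∫⁻ p, edist p.1 p.2 ^ 2 ∂π := by
  rw [W2, ← ENNReal.rpow_natCast, ← ENNReal.rpow_mul]
  norm_num

theorem W2_sq_le [PseudoEMetricSpace E] {μ ν : Measure E} {π : Measure (E × E)}
    (hπ : π ∈ couplings μ ν) : W2 μ ν ^ 2 ≤ ∫⁻ p, edist p.1 p.2 ^ 2 ∂π := by
  rw [W2_sq]; exact iInf₂_le π hπ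

/-- Moves an affine bound from each coupling to the infimum; dividing by `c` is what requires it to
be nonzero and finite. -/
theorem le_mul_W2_sq_add [PseudoEMetricSpace E] {μ ν : Measure E} {x c e : ℝ≥0∞}
    (hc0 : c ≠ 0) (hc : c ≠ ∞)
    (h : ∀ π ∈ couplings μ ν, x ≤ c * ∫⁻ p, edist p.1 p.2 ^ 2 ∂π + e) :
    x ≤ c * W2 μ ν ^ 2 + e := by
  rw [← tsub_le_iff_right, mul_comm, ← ENNReal.div_le_iff hc0 hc, W2_sq]
  refine le_iInf₂ fun π hπ => ?_
  rw [ENNReal.div_le_iff hc0 hc, mul_comm, tsub_le_iff_right]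
  exact h π hπ

end Basic

/-! ### Triangle inequality by gluing -/

section Triangle

variable {E : Type*} [PseudoEMetricSpace E] [MeasurableSpace E] [OpensMeasurableSpace E]
  [SecondCountableTopology E] [StandardBorelSpace E] [Nonempty E]

/-- Disintegrate both couplings over the common marginal `ν` and make the outer points conditionally
independent given the middle one. The weak form with factors 2 avoids Minkowski's inequality and
suffices for the constants needed. -/
theorem exists_glued_coupling {μ ν η : Measure E} [IsProbabilityMeasure μ]
    [IsProbabilityMeasure ν] {π₁ π₂ : Measure (E × E)}
    (h₁ : π₁ ∈ couplings μ ν) (h₂ : π₂ ∈ couplings ν η) :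
    ∃ π ∈ couplings μ η, ∫⁻ p, edist p.1 p.2 ^ 2 ∂π
      ≤ 2 * ∫⁻ p, edist p.1 p.2 ^ 2 ∂π₁ + 2 * ∫⁻ p, edist p.1 p.2 ^ 2 ∂π₂ := by
  have := isProbabilityMeasure_of_mem_couplings h₁
  have := isProbabilityMeasure_of_mem_couplings h₂
  set σ := π₁.map Prod.swap with hσ
  have : IsProbabilityMeasure σ := isProbabilityMeasure_of_mem_couplings (swap_mem_couplings h₁)
  have e₁ : ν ⊗ₘ σ.condKernel = σ := by
    conv_rhs => rw [← σ.disintegrate σ.condKernel]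
    rw [Measure.fst, (swap_mem_couplings h₁).1]
  have e₂ : ν ⊗ₘ π₂.condKernel = π₂ := by
    conv_rhs => rw [← π₂.disintegrate π₂.condKernel]
    rw [Measure.fst, h₂.1]
  set τ := ν ⊗ₘ (σ.condKernel ×ₖ π₂.condKernel) with hτ
  have f₁ : ∀ f : E × E → ℝ≥0∞, Measurable f →
      ∫⁻ q, f (q.2.1, q.1) ∂τ = ∫⁻ p, f p ∂π₁ := by
    intro f hf
    have : ∫⁻ p, f p ∂π₁ = ∫⁻ p, f p.swap ∂σ := by
      rw [hσ, lintegral_map (by fun_prop) measurable_swap]; simp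
    rw [this, ← e₁, hτ, Measure.lintegral_compProd (by fun_prop),
      Measure.lintegral_compProd (by fun_prop)]
    refine lintegral_congr fun y => ?_
    rw [Kernel.prod_apply, lintegral_prod _ (by fun_prop)]
    simp
  have f₂ : ∀ f : E × E → ℝ≥0∞, Measurable f →
      ∫⁻ q, f (q.1, q.2.2) ∂τ = ∫⁻ p, f p ∂π₂ := by
    intro f hf
    rw [← e₂, hτ, Measure.lintegral_compProd (by fun_prop),
      Measure.lintegral_compProd (by fun_prop)]
    refine lintegral_congr fun y => ?_
    rw [Kernel.prod_apply, lintegral_prod _ (by fun_prop)]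
    simp
  refine ⟨τ.map Prod.snd, ⟨?_, ?_⟩, ?_⟩
  · rw [← h₁.1]
    refine Measure.ext_of_lintegral _ fun f hf => ?_
    rw [lintegral_map hf measurable_fst, lintegral_map (by fun_prop) measurable_snd,
      lintegral_map hf measurable_fst, ← f₁ _ (by fun_prop)]
  · rw [← h₂.2]
    refine Measure.ext_of_lintegral _ fun f hf => ?_
    rw [lintegral_map hf measurable_snd, lintegral_map (by fun_prop) measurable_snd,
      lintegral_map hf measurable_snd, ← f₂ _ (by fun_prop)]
  · have hm : Measurable fun p : E × E => edist p.1 p.2 ^ 2 := by fun_prop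
    rw [lintegral_map hm measurable_snd, ← f₁ _ hm, ← f₂ _ hm,
      ← lintegral_const_mul _ (by fun_prop), ← lintegral_const_mul _ (by fun_prop),
      ← lintegral_add_left (by fun_prop)]
    exact lintegral_mono fun q => edist_sq_le_two_mul _ _ _

theorem W2_sq_triangle (μ ν η : Measure E) [IsProbabilityMeasure μ] [IsProbabilityMeasure ν] :
    W2 μ η ^ 2 ≤ 2 * W2 μ ν ^ 2 + 2 * W2 ν η ^ 2 := by
  refine le_mul_W2_sq_add (by simp) (by simp) fun π₁ h₁ => ?_
  rw [add_comm]
  refine le_mul_W2_sq_add (by simp) (by simp) fun π₂ h₂ => ?_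
  obtain ⟨π, hπ, h⟩ := exists_glued_coupling h₁ h₂
  rw [add_comm]
  exact (W2_sq_le hπ).trans h

end Triangle

theorem lintegral_enorm_sq_le_W2 {E : Type*} [SeminormedAddCommGroup E] [MeasurableSpace E]
    [OpensMeasurableSpace E] [SecondCountableTopology E] (μ ν : Measure E) :
    ∫⁻ y, ‖y‖ₑ ^ 2 ∂ν ≤ 2 * W2 μ ν ^ 2 + 2 * ∫⁻ x, ‖x‖ₑ ^ 2 ∂μ := by
  refine le_mul_W2_sq_add (by simp) (by simp) fun π hπ => ?_
  have hm : Measurable fun x : E => ‖x‖ₑ ^ 2 := by fun_prop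
  rw [← lintegral_snd_of_mem_couplings hπ hm.aemeasurable,
    ← lintegral_fst_of_mem_couplings hπ hm.aemeasurable, add_comm,
    ← lintegral_const_mul _ (by fun_prop), ← lintegral_const_mul _ (by fun_prop),
    ← lintegral_add_left (by fun_prop)]
  exact lintegral_mono fun q => enorm_sq_le_two_mul _ _

/-! ### Completing a density to a coupling -/

noncomputable section

section Density

variable {E : Type*} [MeasurableSpace E]

/-- The density `x ↦ ∫ F(x, y) dν(y)` of the first marginal of `F · (μ × ν)`. -/
def rowMass (ν : Measure E) (F : E × E → ℝ≥0∞) (x : E) : ℝ≥0∞ := ∫⁻ y, F (x, y) ∂ν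

/-- The density `y ↦ ∫ F(x, y) dμ(x)` of the second marginal of `F · (μ × ν)`. -/
def colMass (μ : Measure E) (F : E × E → ℝ≥0∞) (y : E) : ℝ≥0∞ := ∫⁻ x, F (x, y) ∂μ

/-- `F` scaled down so that both of its marginal densities are at most `1`. -/
def clipDensity (μ ν : Measure E) (F : E × E → ℝ≥0∞) (p : E × E) : ℝ≥0∞ :=
  F p / max 1 (rowMass ν F p.1) / max 1 (colMass μ F p.2)

/-- `F` completed to the density of a coupling by the normalized product of what its marginals
lack. -/
def fillDensity (μ ν : Measure E) (F : E × E → ℝ≥0∞) (p : E × E) : ℝ≥0∞ :=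
  F p + (1 - rowMass ν F p.1) * ((1 - colMass μ F p.2) / (1 - ∫⁻ q, F q ∂(μ.prod ν)))

variable {μ ν : Measure E} {F : E × E → ℝ≥0∞}

theorem measurable_rowMass [SFinite ν] (hF : Measurable F) : Measurable (rowMass ν F) :=
  hF.lintegral_prod_right'

theorem measurable_colMass [SFinite μ] (hF : Measurable F) : Measurable (colMass μ F) :=
  hF.lintegral_prod_left'

theorem measurable_clipDensity [SFinite μ] [SFinite ν] (hF : Measurable F) :
    Measurable (clipDensity μ ν F) := by
  have := measurable_rowMass (ν := ν) hF
  have := measurable_colMass (μ := μ) hF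
  unfold clipDensity
  fun_prop

theorem measurable_fillDensity [SFinite μ] [SFinite ν] (hF : Measurable F) :
    Measurable (fillDensity μ ν F) := by
  have := measurable_rowMass (ν := ν) hF
  have := measurable_colMass (μ := μ) hF
  unfold fillDensity
  fun_prop

theorem rowMass_clipDensity_le [SFinite ν] (hF : Measurable F) (x : E) :
    rowMass ν (clipDensity μ ν F) x ≤ 1 := by
  calc rowMass ν (clipDensity μ ν F) x
      ≤ ∫⁻ y, F (x, y) * (max 1 (rowMass ν F x))⁻¹ ∂ν := by
        refine lintegral_mono fun y => ?_
        unfold clipDensity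
        rw [← div_eq_mul_inv]
        refine ENNReal.div_le_of_le_mul ?_
        exact le_mul_of_one_le_right zero_le (le_max_left _ _)
    _ = rowMass ν F x / max 1 (rowMass ν F x) := by
        rw [lintegral_mul_const _ (by fun_prop), div_eq_mul_inv, rowMass]
    _ ≤ 1 := ENNReal.div_le_of_le_mul (by simp)

theorem colMass_clipDensity_le [SFinite μ] (hF : Measurable F) (y : E) :
    colMass μ (clipDensity μ ν F) y ≤ 1 := by
  calc colMass μ (clipDensity μ ν F) y
      ≤ ∫⁻ x, F (x, y) * (max 1 (colMass μ F y))⁻¹ ∂μ := by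
        refine lintegral_mono fun x => ?_
        unfold clipDensity
        rw [← div_eq_mul_inv]
        gcongr
        refine ENNReal.div_le_of_le_mul ?_
        exact le_mul_of_one_le_right zero_le (le_max_left _ _)
    _ = colMass μ F y / max 1 (colMass μ F y) := by
        rw [lintegral_mul_const _ (by fun_prop), div_eq_mul_inv, colMass]
    _ ≤ 1 := ENNReal.div_le_of_le_mul (by simp)

/-- Clipping makes any `F` admissible for any pair of measures; the densities used for approximation
are already admissible and pass unchanged. -/
theorem clipDensity_eq_self (hr : ∀ x, rowMass ν F x ≤ 1) (hc : ∀ y, colMass μ F y ≤ 1) :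
    clipDensity μ ν F = F := by
  funext p
  simp [clipDensity, max_eq_left (hr _), max_eq_left (hc _)]

theorem lintegral_rowMass [SFinite ν] (hF : Measurable F) :
    ∫⁻ x, rowMass ν F x ∂μ = ∫⁻ q, F q ∂(μ.prod ν) := by
  rw [lintegral_prod _ hF.aemeasurable]; rfl

theorem lintegral_colMass [SFinite μ] [SFinite ν] (hF : Measurable F) :
    ∫⁻ y, colMass μ F y ∂ν = ∫⁻ q, F q ∂(μ.prod ν) := by
  rw [lintegral_prod_symm _ hF.aemeasurable]; rfl

theorem lintegral_one_sub [IsProbabilityMeasure μ] {f : E → ℝ≥0∞} (hf : Measurable f)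
    (h : ∀ x, f x ≤ 1) : ∫⁻ x, 1 - f x ∂μ = 1 - ∫⁻ x, f x ∂μ := by
  rw [lintegral_sub hf _ (Filter.Eventually.of_forall h)]
  · simp
  · refine ((lintegral_mono h).trans_lt ?_).ne
    simp

/-- Complementary factors that integrate to `1` almost everywhere. -/
theorem ae_add_one_sub_mul_eq_one [IsProbabilityMeasure μ] {f : E → ℝ≥0∞} (hf : Measurable f)
    (h : ∀ x, f x ≤ 1) :
    ∀ᵐ x ∂μ, f x + (1 - f x) * ((1 - ∫⁻ x, f x ∂μ) / (1 - ∫⁻ x, f x ∂μ)) = 1 := by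
  have hI := lintegral_one_sub (μ := μ) hf h
  by_cases h0 : 1 - ∫⁻ x, f x ∂μ = 0
  -- With no missing mass the quotient is `0 / 0 = 0`, but then `f = 1` almost everywhere and no
  -- correction is needed.
  · rw [h0, lintegral_eq_zero_iff (by fun_prop)] at hI
    filter_upwards [hI] with x hx
    have hx : 1 - f x = 0 := hx
    rw [hx, zero_mul, add_zero]
    exact le_antisymm (h x) (tsub_eq_zero_iff_le.1 hx)
  · refine Filter.Eventually.of_forall fun x => ?_
    rw [ENNReal.div_self h0 (by simp), mul_one, add_tsub_cancel_of_le (h x)]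

/-- The normalized factor in the second variable has integral 1, or 0 when no mass is missing, so it
can be integrated out. -/
theorem lintegral_mul_one_sub_div_le {μ ν : Measure E} [IsProbabilityMeasure ν]
    {f g h : E → ℝ≥0∞} (hf : Measurable f) (hg : Measurable g) (hh : Measurable h)
    (hg1 : ∀ x, g x ≤ 1) :
    ∫⁻ p, h p.1 * ((1 - f p.1) * ((1 - g p.2) / (1 - ∫⁻ y, g y ∂ν))) ∂(μ.prod ν)
      ≤ ∫⁻ x, h x * (1 - f x) ∂μ := by
  simp_rw [← mul_assoc (h _)]
  rw [lintegral_prod_mul (f := fun x => h x * (1 - f x))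
    (g := fun y => (1 - g y) / (1 - ∫⁻ y, g y ∂ν)) (by fun_prop) (by fun_prop)]
  simp_rw [div_eq_mul_inv]
  rw [lintegral_mul_const _ (by fun_prop), lintegral_one_sub hg hg1, ← div_eq_mul_inv]
  exact mul_le_of_le_one_right zero_le ENNReal.div_self_le_one

theorem rowMass_fillDensity [IsProbabilityMeasure μ] [IsProbabilityMeasure ν] (hF : Measurable F)
    (hr : ∀ x, rowMass ν F x ≤ 1) (hc : ∀ y, colMass μ F y ≤ 1) :
    ∀ᵐ x ∂μ, rowMass ν (fillDensity μ ν F) x = 1 := by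
  have hrm := measurable_rowMass (ν := ν) hF
  have hcm := measurable_colMass (μ := μ) hF
  filter_upwards [ae_add_one_sub_mul_eq_one (μ := μ) hrm hr] with x hx
  rw [← hx]
  unfold fillDensity
  conv_lhs => rw [rowMass]
  rw [lintegral_add_left (by fun_prop)]
  dsimp only
  rw [lintegral_const_mul _ (by fun_prop)]
  simp_rw [div_eq_mul_inv]
  rw [lintegral_mul_const _ (by fun_prop), lintegral_one_sub hcm hc, lintegral_colMass hF,
    lintegral_rowMass hF]
  rfl

theorem colMass_fillDensity [IsProbabilityMeasure μ] [IsProbabilityMeasure ν] (hF : Measurable F)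
    (hr : ∀ x, rowMass ν F x ≤ 1) (hc : ∀ y, colMass μ F y ≤ 1) :
    ∀ᵐ y ∂ν, colMass μ (fillDensity μ ν F) y = 1 := by
  have hrm := measurable_rowMass (ν := ν) hF
  have hcm := measurable_colMass (μ := μ) hF
  filter_upwards [ae_add_one_sub_mul_eq_one (μ := ν) hcm hc] with x hx
  rw [← hx]
  unfold fillDensity
  conv_lhs => rw [colMass]
  rw [lintegral_add_left (by fun_prop)]
  dsimp only
  rw [lintegral_mul_const _ (by fun_prop),
    lintegral_one_sub hrm hr, lintegral_colMass hF, lintegral_rowMass hF]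
  simp_rw [div_eq_mul_inv, mul_left_comm (1 - ∫⁻ q, F q ∂(μ.prod ν))]
  rfl

theorem withDensity_mem_couplings [SFinite μ] [SFinite ν] (hF : Measurable F)
    (hr : ∀ᵐ x ∂μ, rowMass ν F x = 1) (hc : ∀ᵐ y ∂ν, colMass μ F y = 1) :
    (μ.prod ν).withDensity F ∈ couplings μ ν := by
  constructor
  · refine Measure.ext_of_lintegral _ fun f hf => ?_
    rw [lintegral_map hf measurable_fst,
      lintegral_withDensity_eq_lintegral_mul _ hF (by fun_prop),
      lintegral_prod _ (by fun_prop)]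
    refine lintegral_congr_ae (hr.mono fun x hx => ?_)
    simp only [Pi.mul_apply]
    rw [lintegral_mul_const _ (by fun_prop)]
    unfold rowMass at hx
    rw [hx, one_mul]
  · refine Measure.ext_of_lintegral _ fun f hf => ?_
    rw [lintegral_map hf measurable_snd,
      lintegral_withDensity_eq_lintegral_mul _ hF (by fun_prop),
      lintegral_prod_symm _ (by fun_prop)]
    refine lintegral_congr_ae (hc.mono fun x hx => ?_)
    simp only [Pi.mul_apply]
    rw [lintegral_mul_const _ (by fun_prop)]
    unfold colMass at hx
    rw [hx, one_mul]

theorem withDensity_fillDensity_mem_couplings [IsProbabilityMeasure μ] [IsProbabilityMeasure ν]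
    (hF : Measurable F) (hr : ∀ x, rowMass ν F x ≤ 1) (hc : ∀ y, colMass μ F y ≤ 1) :
    (μ.prod ν).withDensity (fillDensity μ ν F) ∈ couplings μ ν :=
  withDensity_mem_couplings (measurable_fillDensity hF) (rowMass_fillDensity hF hr hc)
    (colMass_fillDensity hF hr hc)

end Density

/-- On the filled-in part, `‖x - y‖² ≤ 2‖x‖² + 2‖y‖²` separates the variables. The price of
completion is thus second moments weighted by the missing marginal mass, which tends to 0 as that
mass does. -/
theorem lintegral_withDensity_fillDensity_le {E : Type*} [SeminormedAddCommGroup E]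
    [MeasurableSpace E] [OpensMeasurableSpace E] [SecondCountableTopology E] {μ ν : Measure E}
    [IsProbabilityMeasure μ] [IsProbabilityMeasure ν] {F : E × E → ℝ≥0∞} (hF : Measurable F)
    (hr : ∀ x, rowMass ν F x ≤ 1) (hc : ∀ y, colMass μ F y ≤ 1) :
    ∫⁻ p, edist p.1 p.2 ^ 2 ∂((μ.prod ν).withDensity (fillDensity μ ν F))
      ≤ ∫⁻ p, edist p.1 p.2 ^ 2 * F p ∂(μ.prod ν)
        + (2 * ∫⁻ x, ‖x‖ₑ ^ 2 * (1 - rowMass ν F x) ∂μ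
          + 2 * ∫⁻ y, ‖y‖ₑ ^ 2 * (1 - colMass μ F y) ∂ν) := by
  have hrm := measurable_rowMass (ν := ν) hF
  have hcm := measurable_colMass (μ := μ) hF
  set m := ∫⁻ q, F q ∂(μ.prod ν) with hm
  have hm1 : m = ∫⁻ y, colMass μ F y ∂ν := (lintegral_colMass hF).symm
  have hm2 : m = ∫⁻ x, rowMass ν F x ∂μ := (lintegral_rowMass hF).symm
  have hn : Measurable fun x : E => ‖x‖ₑ ^ 2 := by fun_prop
  rw [lintegral_withDensity_eq_lintegral_mul _ (measurable_fillDensity hF) (by fun_prop)]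
  have A := lintegral_mul_one_sub_div_le (μ := μ) (ν := ν) hrm hcm hn hc
  have B := lintegral_mul_one_sub_div_le (μ := ν) (ν := μ) hcm hrm hn hr
  rw [← hm1] at A
  rw [← hm2, ← lintegral_prod_swap] at B
  calc _ ≤ ∫⁻ p, (edist p.1 p.2 ^ 2 * F p
        + (2 * (‖p.1‖ₑ ^ 2 * ((1 - rowMass ν F p.1) * ((1 - colMass μ F p.2) / (1 - m))))
          + 2 * (‖p.2‖ₑ ^ 2 * ((1 - colMass μ F p.2) * ((1 - rowMass ν F p.1) / (1 - m))))))
          ∂(μ.prod ν) := by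
        refine lintegral_mono fun p => ?_
        simp only [Pi.mul_apply, fillDensity]
        rw [add_mul, mul_comm (F p)]
        gcongr
        calc _ ≤ (1 - rowMass ν F p.1) * ((1 - colMass μ F p.2) / (1 - m))
              * (2 * ‖p.1‖ₑ ^ 2 + 2 * ‖p.2‖ₑ ^ 2) := by gcongr; exact edist_sq_le_enorm _ _
          _ = _ := by simp only [div_eq_mul_inv]; ring
    _ ≤ _ := by
        rw [lintegral_add_left (by fun_prop), lintegral_add_left (by fun_prop),
          lintegral_const_mul _ (by fun_prop), lintegral_const_mul _ (by fun_prop)]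
        gcongr
        exact B

end

/-! ### Countable approximation from below -/

open Filter Topology

/-- Countably many nonnegative functions on `ℕ × ℕ` approximate every finite one from below. -/
theorem exists_countable_approx_from_below :
    ∃ S : ℕ → ℕ × ℕ → ℝ≥0∞, ∀ φ : ℕ × ℕ → ℝ≥0∞, (∀ q, φ q ≠ ∞) →
      ∃ k : ℕ → ℕ, (∀ n q, S (k n) q ≤ φ q) ∧
        ∀ q, Tendsto (fun n => S (k n) q) atTop (𝓝 (φ q)) := by
  obtain ⟨s, hs⟩ := exists_surjective_nat (ℕ × (ℕ × ℕ →₀ ℕ))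
  refine ⟨fun k q => ENNReal.ofReal ((s k).2 q / (s k).1), fun φ hφ => ?_⟩
  -- The `n`-th approximant is `⌊n φ⌋ / n` on the square `[0, n)²` and 0 outside it: a denominator
  -- with a finitely supported numerator, hence one of countably many.
  choose k hk using fun n : ℕ => hs (n, Finsupp.onFinset (Finset.range n ×ˢ Finset.range n)
    (fun q => if q ∈ Finset.range n ×ˢ Finset.range n then ⌊(φ q).toReal * n⌋₊ else 0)
    (fun q hq => by by_contra h; simp [h] at hq))
  refine ⟨k, fun n q => ?_, fun q => ?_⟩
  · simp only [hk, Finsupp.onFinset_apply]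
    split_ifs with h
    · refine ENNReal.ofReal_le_of_le_toReal ?_
      have hn : 0 < n := by
        rcases Nat.eq_zero_or_pos n with rfl | h'
        · simp at h
        · exact h'
      rw [div_le_iff₀ (by exact_mod_cast hn)]
      exact Nat.floor_le (by positivity)
    · simp
  · have h1 : Tendsto (fun n : ℕ => (⌊(φ q).toReal * n⌋₊ : ℝ) / n) atTop (𝓝 (φ q).toReal) :=
      (tendsto_nat_floor_mul_div_atTop ENNReal.toReal_nonneg).comp tendsto_natCast_atTop_atTop
    have h2 := ENNReal.tendsto_ofReal h1
    rw [ENNReal.ofReal_toReal (hφ q)] at h2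
    refine h2.congr' ?_
    filter_upwards [eventually_gt_atTop (max q.1 q.2)] with n hn
    have : q ∈ Finset.range n ×ˢ Finset.range n := by
      simp only [Finset.mem_product, Finset.mem_range]; omega
    simp only [hk, Finsupp.onFinset_apply, if_pos this]

/-! ### Discretizing a coupling along a countable partition -/

section Cells

variable {E : Type*} [MeasurableSpace E] {μ ν : Measure E} {π : Measure (E × E)} {ι : E → ℕ}

/-- The mass that `π` gives to a product of cells, relative to the mass that `μ × ν` gives. -/
noncomputable def cellRatio (μ ν : Measure E) (π : Measure (E × E)) (ι : E → ℕ) (q : ℕ × ℕ) :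
    ℝ≥0∞ :=
  π.map (Prod.map ι ι) {q} / (μ.map ι {q.1} * ν.map ι {q.2})

theorem map_map_singleton_le_left (hπ : π ∈ couplings μ ν) (hι : Measurable ι) (q : ℕ × ℕ) :
    π.map (Prod.map ι ι) {q} ≤ μ.map ι {q.1} := by
  rw [← hπ.1, Measure.map_map hι measurable_fst,
    Measure.map_apply (by fun_prop) (measurableSet_singleton _),
    Measure.map_apply (by fun_prop) (measurableSet_singleton _)]
  refine measure_mono fun p hp => ?_
  simp only [Set.mem_preimage, Set.mem_singleton_iff, Function.comp] at hp ⊢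
  rw [← hp]; rfl

theorem map_map_singleton_le_right (hπ : π ∈ couplings μ ν) (hι : Measurable ι) (q : ℕ × ℕ) :
    π.map (Prod.map ι ι) {q} ≤ ν.map ι {q.2} := by
  rw [← hπ.2, Measure.map_map hι measurable_snd,
    Measure.map_apply (by fun_prop) (measurableSet_singleton _),
    Measure.map_apply (by fun_prop) (measurableSet_singleton _)]
  refine measure_mono fun p hp => ?_
  simp only [Set.mem_preimage, Set.mem_singleton_iff, Function.comp] at hp ⊢
  rw [← hp]; rfl

theorem tsum_map_map_singleton_left (hπ : π ∈ couplings μ ν) (hι : Measurable ι) (i : ℕ) :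
    ∑' j, π.map (Prod.map ι ι) {(i, j)} = μ.map ι {i} := by
  rw [← measure_iUnion (by intro a b hab; simpa [Function.onFun] using hab)
      (fun j => measurableSet_singleton _), ← hπ.1, Measure.map_map hι measurable_fst,
    Measure.map_apply (by fun_prop) (by measurability),
    Measure.map_apply (by fun_prop) (measurableSet_singleton _)]
  congr 1
  ext p
  simp [Prod.ext_iff, eq_comm]

theorem tsum_map_map_singleton_right (hπ : π ∈ couplings μ ν) (hι : Measurable ι) (j : ℕ) :
    ∑' i, π.map (Prod.map ι ι) {(i, j)} = ν.map ι {j} := by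
  rw [← measure_iUnion (by intro a b hab; simpa [Function.onFun] using hab)
      (fun j => measurableSet_singleton _), ← hπ.2, Measure.map_map hι measurable_snd,
    Measure.map_apply (by fun_prop) (by measurability),
    Measure.map_apply (by fun_prop) (measurableSet_singleton _)]
  congr 1
  ext p
  simp [Prod.ext_iff, eq_comm]

theorem cellRatio_ne_top [IsProbabilityMeasure μ] (hπ : π ∈ couplings μ ν) (hι : Measurable ι)
    (q : ℕ × ℕ) : cellRatio μ ν π ι q ≠ ∞ := by
  have := isProbabilityMeasure_of_mem_couplings hπ
  have h1 := map_map_singleton_le_left hπ hι q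
  have h2 := map_map_singleton_le_right hπ hι q
  unfold cellRatio
  by_cases h : π.map (Prod.map ι ι) {q} = 0
  · simp [h]
  · refine ENNReal.div_ne_top (measure_ne_top _ _) (mul_ne_zero ?_ ?_)
    · exact fun h0 => h (le_antisymm (h0 ▸ h1) zero_le)
    · exact fun h0 => h (le_antisymm (h0 ▸ h2) zero_le)

variable [IsProbabilityMeasure μ] [IsProbabilityMeasure ν]

theorem cellRatio_mul (hπ : π ∈ couplings μ ν) (hι : Measurable ι) (q : ℕ × ℕ) :
    cellRatio μ ν π ι q * (μ.map ι {q.1} * ν.map ι {q.2}) = π.map (Prod.map ι ι) {q} := by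
  unfold cellRatio
  refine ENNReal.div_mul_cancel' (fun h => ?_) (fun h => ?_)
  · rcases mul_eq_zero.1 h with h | h
    · exact le_antisymm (h ▸ map_map_singleton_le_left hπ hι q) zero_le
    · exact le_antisymm (h ▸ map_map_singleton_le_right hπ hι q) zero_le
  · exact absurd h (ENNReal.mul_ne_top (measure_ne_top _ _) (measure_ne_top _ _))

/-- Replacing `π` by the measure with density `cellRatio` relative to `μ × ν` keeps the mass of
every product of cells, hence the integral of every function of the cells. -/
theorem lintegral_mul_cellRatio (hπ : π ∈ couplings μ ν) (hι : Measurable ι)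
    (g : ℕ × ℕ → ℝ≥0∞) :
    ∫⁻ p, g (Prod.map ι ι p) * cellRatio μ ν π ι (Prod.map ι ι p) ∂(μ.prod ν)
      = ∫⁻ p, g (Prod.map ι ι p) ∂π := by
  have hJ : Measurable (Prod.map ι ι) := hι.prodMap hι
  have hg : ∀ g : ℕ × ℕ → ℝ≥0∞, Measurable g := fun g => measurable_of_countable g
  rw [← lintegral_map (f := fun q => g q * cellRatio μ ν π ι q) (hg _) hJ,
    ← lintegral_map (hg g) hJ, ← Measure.map_prod_map _ _ hι hι,
    lintegral_countable', lintegral_countable']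
  refine tsum_congr fun q => ?_
  rw [← cellRatio_mul hπ hι q, mul_assoc]
  congr 2
  rw [← Set.singleton_prod_singleton, Measure.prod_prod]

theorem rowMass_cellRatio_le (hπ : π ∈ couplings μ ν) (hι : Measurable ι) (x : E) :
    rowMass ν (cellRatio μ ν π ι ∘ Prod.map ι ι) x ≤ 1 := by
  have hg : ∀ g : ℕ → ℝ≥0∞, Measurable g := fun g => measurable_of_countable g
  simp only [rowMass, Function.comp, Prod.map]
  rw [← lintegral_map (f := fun j => cellRatio μ ν π ι (ι x, j)) (hg _) hι,
    lintegral_countable']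
  calc ∑' j, cellRatio μ ν π ι (ι x, j) * ν.map ι {j}
      ≤ ∑' j, π.map (Prod.map ι ι) {(ι x, j)} * (μ.map ι {ι x})⁻¹ := by
        refine ENNReal.tsum_le_tsum fun j => ?_
        rw [← div_eq_mul_inv]
        -- A null cell carries no mass of `π` either, so the ratio there is `0 / 0 = 0`.
        by_cases h : μ.map ι {ι x} = 0
        · have := map_map_singleton_le_left hπ hι (ι x, j)
          simp only [h, nonpos_iff_eq_zero] at this
          simp [cellRatio, this]
        · rw [ENNReal.le_div_iff_mul_le (Or.inl h) (Or.inl (measure_ne_top _ _)),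
            ← cellRatio_mul hπ hι (ι x, j)]
          exact (by ring : _ = _).le
    _ = μ.map ι {ι x} / μ.map ι {ι x} := by
        rw [ENNReal.tsum_mul_right, tsum_map_map_singleton_left hπ hι, div_eq_mul_inv]
    _ ≤ 1 := ENNReal.div_self_le_one

theorem colMass_cellRatio_le (hπ : π ∈ couplings μ ν) (hι : Measurable ι) (y : E) :
    colMass μ (cellRatio μ ν π ι ∘ Prod.map ι ι) y ≤ 1 := by
  have hg : ∀ g : ℕ → ℝ≥0∞, Measurable g := fun g => measurable_of_countable g
  simp only [colMass, Function.comp, Prod.map]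
  rw [← lintegral_map (f := fun i => cellRatio μ ν π ι (i, ι y)) (hg _) hι,
    lintegral_countable']
  calc ∑' i, cellRatio μ ν π ι (i, ι y) * μ.map ι {i}
      ≤ ∑' i, π.map (Prod.map ι ι) {(i, ι y)} * (ν.map ι {ι y})⁻¹ := by
        refine ENNReal.tsum_le_tsum fun i => ?_
        rw [← div_eq_mul_inv]
        by_cases h : ν.map ι {ι y} = 0
        · have := map_map_singleton_le_right hπ hι (i, ι y)
          simp only [h, nonpos_iff_eq_zero] at this
          simp [cellRatio, this]
        · rw [ENNReal.le_div_iff_mul_le (Or.inl h) (Or.inl (measure_ne_top _ _)),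
            ← cellRatio_mul hπ hι (i, ι y)]
          exact (by ring : _ = _).le
    _ = ν.map ι {ι y} / ν.map ι {ι y} := by
        rw [ENNReal.tsum_mul_right, tsum_map_map_singleton_right hπ hι, div_eq_mul_inv]
    _ ≤ 1 := ENNReal.div_self_le_one

theorem ae_eq_one_of_lintegral_eq_one {f : E → ℝ≥0∞} (h : ∀ x, f x ≤ 1)
    (hI : ∫⁻ x, f x ∂μ = 1) : ∀ᵐ x ∂μ, f x = 1 :=
  ae_eq_of_ae_le_of_lintegral_le (g := fun _ => 1) (Eventually.of_forall h)
    (by simp [hI]) aemeasurable_const (by simp [hI])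

theorem ae_rowMass_cellRatio (hπ : π ∈ couplings μ ν) (hι : Measurable ι) :
    ∀ᵐ x ∂μ, rowMass ν (cellRatio μ ν π ι ∘ Prod.map ι ι) x = 1 := by
  have := isProbabilityMeasure_of_mem_couplings hπ
  refine ae_eq_one_of_lintegral_eq_one (rowMass_cellRatio_le hπ hι) ?_
  rw [lintegral_rowMass ((measurable_of_countable _).comp (hι.prodMap hι))]
  simpa using lintegral_mul_cellRatio hπ hι (fun _ => 1)

theorem ae_colMass_cellRatio (hπ : π ∈ couplings μ ν) (hι : Measurable ι) :
    ∀ᵐ y ∂ν, colMass μ (cellRatio μ ν π ι ∘ Prod.map ι ι) y = 1 := by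
  have := isProbabilityMeasure_of_mem_couplings hπ
  refine ae_eq_one_of_lintegral_eq_one (colMass_cellRatio_le hπ hι) ?_
  rw [lintegral_colMass ((measurable_of_countable _).comp (hι.prodMap hι))]
  simpa using lintegral_mul_cellRatio hπ hι (fun _ => 1)

end Cells

/-- The cross term satisfies `8δs ≤ δ(s² + 16)`, which is `δ(s - 4)² ≥ 0`. -/
theorem ENNReal.add_four_mul_sq_le (s : ℝ≥0∞) (δ : ℝ≥0) :
    (s + 4 * δ) ^ 2 ≤ (1 + δ) * s ^ 2 + (16 * δ ^ 2 + 16 * δ) := by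
  rcases eq_or_ne s ∞ with rfl | hs
  · simp
  lift s to ℝ≥0 using hs
  norm_cast
  rw [← NNReal.coe_le_coe]
  push_cast
  nlinarith [mul_nonneg δ.coe_nonneg (sq_nonneg ((s : ℝ) - 4))]

/-- Each point is assigned to the first point of a dense sequence within distance `δ`. -/
theorem exists_measurable_cells (E : Type*) [PseudoEMetricSpace E] [MeasurableSpace E]
    [OpensMeasurableSpace E] [SecondCountableTopology E] [Nonempty E] {δ : ℝ≥0∞} (hδ : 0 < δ) :
    ∃ (ι : E → ℕ) (z : ℕ → E), Measurable ι ∧ ∀ x, edist x (z (ι x)) ≤ δ := by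
  classical
  have h : ∀ x : E, ∃ n, edist x (TopologicalSpace.denseSeq E n) < δ := fun x => by
    obtain ⟨_, ⟨n, rfl⟩, hn⟩ := EMetric.mem_closure_iff.1
      ((TopologicalSpace.denseRange_denseSeq E) x) δ hδ
    exact ⟨n, hn⟩
  refine ⟨fun x => Nat.find (h x), TopologicalSpace.denseSeq E, measurable_find h fun n => ?_,
    fun x => (Nat.find_spec (h x)).le⟩
  exact measurableSet_lt (by fun_prop) measurable_const

/-! ### Vanishing of the missing mass in the limit -/

section Limits

variable {E : Type*} [MeasurableSpace E]

theorem tendsto_rowMass {ν : Measure E} {F : ℕ → E × E → ℝ≥0∞}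
    {G : E × E → ℝ≥0∞} (hF : ∀ n, Measurable (F n)) (hle : ∀ n p, F n p ≤ G p)
    (hlim : ∀ p, Tendsto (fun n => F n p) atTop (𝓝 (G p))) {x : E} (hx : rowMass ν G x ≠ ∞) :
    Tendsto (fun n => rowMass ν (F n) x) atTop (𝓝 (rowMass ν G x)) :=
  tendsto_lintegral_of_dominated_convergence (fun y => G (x, y)) (fun n => by fun_prop)
    (fun n => Eventually.of_forall fun y => hle n _) hx (Eventually.of_forall fun y => hlim _)

theorem tendsto_colMass {μ : Measure E} {F : ℕ → E × E → ℝ≥0∞}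
    {G : E × E → ℝ≥0∞} (hF : ∀ n, Measurable (F n)) (hle : ∀ n p, F n p ≤ G p)
    (hlim : ∀ p, Tendsto (fun n => F n p) atTop (𝓝 (G p))) {y : E} (hy : colMass μ G y ≠ ∞) :
    Tendsto (fun n => colMass μ (F n) y) atTop (𝓝 (colMass μ G y)) :=
  tendsto_lintegral_of_dominated_convergence (fun x => G (x, y)) (fun n => by fun_prop)
    (fun n => Eventually.of_forall fun y => hle n _) hy (Eventually.of_forall fun y => hlim _)

theorem tendsto_lintegral_mul_one_sub {μ : Measure E} {h g : E → ℝ≥0∞} {f : ℕ → E → ℝ≥0∞}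
    (hh : Measurable h) (hI : ∫⁻ x, h x ∂μ ≠ ∞) (hf : ∀ n, Measurable (f n))
    (hlim : ∀ x, Tendsto (fun n => f n x) atTop (𝓝 (g x))) (hg : ∀ᵐ x ∂μ, g x = 1) :
    Tendsto (fun n => ∫⁻ x, h x * (1 - f n x) ∂μ) atTop (𝓝 0) := by
  have hfin := ae_lt_top hh hI
  rw [← lintegral_zero (μ := μ)]
  refine tendsto_lintegral_of_dominated_convergence h (fun n => by fun_prop)
    (fun n => Eventually.of_forall fun x => mul_le_of_le_one_right zero_le tsub_le_self) hI ?_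
  filter_upwards [hg, hfin] with x hx hx'
  have h1 : Tendsto (fun n => 1 - f n x) atTop (𝓝 0) := by
    have := ENNReal.Tendsto.sub (tendsto_const_nhds (x := (1 : ℝ≥0∞)) (f := atTop)) (hlim x)
      (Or.inl ENNReal.one_ne_top)
    rwa [hx, tsub_self] at this
  have := ENNReal.Tendsto.const_mul (a := h x) h1 (Or.inr hx'.ne)
  rwa [mul_zero] at this

end Limits

/-! ### The distance as a countable infimum of density costs -/

section Approx

variable {E : Type*} [SeminormedAddCommGroup E] [MeasurableSpace E]

/-- The quadratic transport cost of the coupling of `μ` and `ν` that `F` is completed to. -/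
noncomputable def densityCost (μ ν : Measure E) (F : E × E → ℝ≥0∞) : ℝ≥0∞ :=
  ∫⁻ p, edist p.1 p.2 ^ 2 ∂((μ.prod ν).withDensity (fillDensity μ ν (clipDensity μ ν F)))

theorem W2_sq_le_densityCost {μ ν : Measure E} [IsProbabilityMeasure μ]
    [IsProbabilityMeasure ν] {F : E × E → ℝ≥0∞} (hF : Measurable F) :
    W2 μ ν ^ 2 ≤ densityCost μ ν F :=
  W2_sq_le (withDensity_fillDensity_mem_couplings (measurable_clipDensity hF)
    (rowMass_clipDensity_le hF) (colMass_clipDensity_le hF))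

/-- Discretizing `π` on cells of radius `δ` changes distances by at most `4δ`: `2δ` from points to
cell centres and `2δ` back. The cell density is then approximated from below by the countable
family; dominated convergence, with the squared norms as majorants, removes the completion cost. The
partition and the family do not depend on `μ` and `ν`. -/
theorem exists_densities_iInf_cost_le_add (E : Type*) [SeminormedAddCommGroup E]
    [MeasurableSpace E] [OpensMeasurableSpace E] [SecondCountableTopology E] {δ : ℝ≥0}
    (hδ : 0 < δ) :
    ∃ F : ℕ → E × E → ℝ≥0∞, (∀ k, Measurable (F k)) ∧
      ∀ (μ ν : Measure E) [IsProbabilityMeasure μ] [IsProbabilityMeasure ν],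
        ∫⁻ x, ‖x‖ₑ ^ 2 ∂μ ≠ ∞ → ∫⁻ x, ‖x‖ₑ ^ 2 ∂ν ≠ ∞ → ∀ π ∈ couplings μ ν,
          ⨅ k, densityCost μ ν (F k) ≤ ∫⁻ p, (edist p.1 p.2 + 4 * δ) ^ 2 ∂π := by
  obtain ⟨ι, z, hι, hz⟩ := exists_measurable_cells E (ENNReal.coe_pos.2 hδ)
  obtain ⟨S, hS⟩ := exists_countable_approx_from_below
  have hJ : Measurable (Prod.map ι ι) := hι.prodMap hι
  have hm : ∀ g : ℕ × ℕ → ℝ≥0∞, Measurable (g ∘ Prod.map ι ι) := fun g =>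
    (measurable_of_countable g).comp hJ
  refine ⟨fun k => S k ∘ Prod.map ι ι, fun k => hm _, fun μ ν _ _ hμ hν π hπ => ?_⟩
  obtain ⟨k, hle, hlim⟩ := hS (cellRatio μ ν π ι) (cellRatio_ne_top hπ hι)
  set G := cellRatio μ ν π ι ∘ Prod.map ι ι with hG
  set F := fun n => S (k n) ∘ Prod.map ι ι with hF
  have hFG : ∀ n p, F n p ≤ G p := fun n p => hle n _
  have hFlim : ∀ p, Tendsto (fun n => F n p) atTop (𝓝 (G p)) := fun p => hlim _
  have hr := rowMass_cellRatio_le hπ hι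
  have hc := colMass_cellRatio_le hπ hι
  have hrn : ∀ n x, rowMass ν (F n) x ≤ 1 := fun n x =>
    (lintegral_mono fun y => hFG n _).trans (hr x)
  have hcn : ∀ n y, colMass μ (F n) y ≤ 1 := fun n y =>
    (lintegral_mono fun x => hFG n _).trans (hc y)
  have hcell : ∫⁻ p, edist p.1 p.2 ^ 2 * G p ∂(μ.prod ν)
      ≤ ∫⁻ p, (edist p.1 p.2 + 4 * δ) ^ 2 ∂π := by
    calc _ ≤ ∫⁻ p, (edist (z (Prod.map ι ι p).1) (z (Prod.map ι ι p).2) + 2 * δ) ^ 2 * G p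
            ∂(μ.prod ν) := by
          refine lintegral_mono fun p => ?_
          gcongr
          refine (edist_triangle4 _ (z (ι p.1)) (z (ι p.2)) _).trans ?_
          rw [edist_comm (z (ι p.2))]
          calc _ ≤ δ + edist (z (ι p.1)) (z (ι p.2)) + δ := by gcongr <;> exact hz _
            _ = _ := by simp only [Prod.map]; ring
      _ = _ := lintegral_mul_cellRatio hπ hι (fun q => (edist (z q.1) (z q.2) + 2 * δ) ^ 2)
      _ ≤ _ := by
          refine lintegral_mono fun p => ?_
          gcongr ?_ ^ 2
          calc _ ≤ edist p.1 (z (ι p.1)) + edist p.1 p.2 + edist p.2 (z (ι p.2)) + 2 * δ := by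
                gcongr
                rw [edist_comm p.1]
                exact edist_triangle4 _ _ _ _
            _ ≤ δ + edist p.1 p.2 + δ + 2 * δ := by gcongr <;> exact hz _
            _ = _ := by ring
  have hcost : ∀ n, ⨅ k, densityCost μ ν (S k ∘ Prod.map ι ι)
      ≤ ∫⁻ p, (edist p.1 p.2 + 4 * δ) ^ 2 ∂π
        + (2 * ∫⁻ x, ‖x‖ₑ ^ 2 * (1 - rowMass ν (F n) x) ∂μ
          + 2 * ∫⁻ y, ‖y‖ₑ ^ 2 * (1 - colMass μ (F n) y) ∂ν) := by
    intro n
    refine (iInf_le _ (k n)).trans ?_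
    change densityCost μ ν (F n) ≤ _
    rw [densityCost, clipDensity_eq_self (hrn n) (hcn n)]
    refine (lintegral_withDensity_fillDensity_le (hm _) (hrn n) (hcn n)).trans ?_
    refine add_le_add_left ((lintegral_mono fun p => ?_).trans hcell) _
    gcongr
    exact hFG n p
  have t1 := tendsto_lintegral_mul_one_sub (μ := μ) (h := fun x => ‖x‖ₑ ^ 2) (by fun_prop) hμ
    (fun n => measurable_rowMass (ν := ν) (hm (S (k n))))
    (fun x => tendsto_rowMass (fun n => hm _) hFG hFlim ((hr x).trans_lt (by simp)).ne)
    (ae_rowMass_cellRatio hπ hι)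
  have t2 := tendsto_lintegral_mul_one_sub (μ := ν) (h := fun x => ‖x‖ₑ ^ 2) (by fun_prop) hν
    (fun n => measurable_colMass (μ := μ) (hm (S (k n))))
    (fun x => tendsto_colMass (fun n => hm _) hFG hFlim ((hc x).trans_lt (by simp)).ne)
    (ae_colMass_cellRatio hπ hι)
  have t3 := ((ENNReal.Tendsto.const_mul (a := 2) t1 (by simp)).add
    (ENNReal.Tendsto.const_mul (a := 2) t2 (by simp))).const_add
    (∫⁻ p, (edist p.1 p.2 + 4 * δ) ^ 2 ∂π)
  simp only [mul_zero, add_zero] at t3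
  exact ge_of_tendsto' t3 hcost

/-- The Wasserstein distance is an infimum over countably many couplings that are given by
densities, the same ones for all pairs of measures. -/
theorem exists_densities_iInf_cost_eq (E : Type*) [SeminormedAddCommGroup E]
    [MeasurableSpace E] [OpensMeasurableSpace E] [SecondCountableTopology E] :
    ∃ F : ℕ → E × E → ℝ≥0∞, (∀ k, Measurable (F k)) ∧
      ∀ (μ ν : Measure E) [IsProbabilityMeasure μ] [IsProbabilityMeasure ν],
        ∫⁻ x, ‖x‖ₑ ^ 2 ∂μ ≠ ∞ → ∫⁻ x, ‖x‖ₑ ^ 2 ∂ν ≠ ∞ →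
          ⨅ k, densityCost μ ν (F k) = W2 μ ν ^ 2 := by
  choose F hFm hF using fun n : ℕ =>
    exists_densities_iInf_cost_le_add E (δ := 1 / (n + 1)) (by positivity)
  refine ⟨fun k => F (Nat.unpair k).1 (Nat.unpair k).2, fun k => hFm _ _, fun μ ν _ _ hμ hν => ?_⟩
  refine le_antisymm ?_ (le_iInf fun k => W2_sq_le_densityCost (hFm _ _))
  rw [W2_sq]
  refine le_iInf₂ fun π hπ => ?_
  have := isProbabilityMeasure_of_mem_couplings hπ
  rcases eq_or_ne (∫⁻ p, edist p.1 p.2 ^ 2 ∂π) ∞ with h | h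
  · rw [h]; exact le_top
  -- The error is taken as `δ = 1 / (n + 1)`; the lists for all `n` are merged into one by the
  -- pairing function.
  have hn : ∀ n : ℕ, ⨅ k, densityCost μ ν (F (Nat.unpair k).1 (Nat.unpair k).2)
      ≤ (((1 + 1 / (n + 1)) * (∫⁻ p, edist p.1 p.2 ^ 2 ∂π).toNNReal
        + (16 * (1 / (n + 1)) ^ 2 + 16 * (1 / (n + 1))) : ℝ≥0) : ℝ≥0∞) := by
    intro n
    have h1 : ⨅ k, densityCost μ ν (F (Nat.unpair k).1 (Nat.unpair k).2)
        ≤ ⨅ k, densityCost μ ν (F n k) := by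
      refine le_iInf fun k => (iInf_le _ (Nat.pair n k)).trans_eq ?_
      simp
    refine h1.trans ((hF n μ ν hμ hν π hπ).trans ?_)
    refine (lintegral_mono fun p => ENNReal.add_four_mul_sq_le _ _).trans_eq ?_
    rw [lintegral_add_right _ (by fun_prop), lintegral_const_mul' _ _ (by finiteness)]
    simp only [lintegral_const, measure_univ, mul_one]
    push_cast
    rw [ENNReal.coe_toNNReal h]
  have hδ : Tendsto (fun n : ℕ => 1 / ((n : ℝ≥0) + 1)) atTop (𝓝 0) :=
    tendsto_one_div_add_atTop_nhds_zero_nat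
  have hlim := ((hδ.const_add 1).mul_const (∫⁻ p, edist p.1 p.2 ^ 2 ∂π).toNNReal).add
    (((hδ.pow 2).const_mul 16).add (hδ.const_mul 16))
  refine (ge_of_tendsto' (ENNReal.tendsto_coe.2 hlim) hn).trans_eq ?_
  simp [ENNReal.coe_toNNReal h]

end Approx

/-! ### Measurable selection of nearly optimal couplings -/

section Selection

variable {A E : Type*} [MeasurableSpace A] [MeasurableSpace E] {κ η : Kernel A E}

theorem measurable_rowMass_kernel [IsSFiniteKernel η] {F : A → E × E → ℝ≥0∞}
    (hF : Measurable (Function.uncurry F)) :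
    Measurable fun q : A × E => rowMass (η q.1) (F q.1) q.2 := by
  have h : Measurable fun r : (A × E) × E => F r.1.1 (r.1.2, r.2) :=
    hF.comp (g := Function.uncurry F) (f := fun r : (A × E) × E => (r.1.1, (r.1.2, r.2)))
      (by fun_prop)
  exact h.lintegral_kernel_prod_right' (κ := η.comap Prod.fst measurable_fst)

theorem measurable_colMass_kernel [IsSFiniteKernel κ] {F : A → E × E → ℝ≥0∞}
    (hF : Measurable (Function.uncurry F)) :
    Measurable fun q : A × E => colMass (κ q.1) (F q.1) q.2 := by
  have h : Measurable fun r : (A × E) × E => F r.1.1 (r.2, r.1.2) :=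
    hF.comp (g := Function.uncurry F) (f := fun r : (A × E) × E => (r.1.1, (r.2, r.1.2)))
      (by fun_prop)
  exact h.lintegral_kernel_prod_right' (κ := κ.comap Prod.fst measurable_fst)

theorem measurable_clipDensity_kernel [IsSFiniteKernel κ] [IsSFiniteKernel η]
    {F : A → E × E → ℝ≥0∞} (hF : Measurable (Function.uncurry F)) :
    Measurable (Function.uncurry fun a => clipDensity (κ a) (η a) (F a)) := by
  have h₁ := (measurable_rowMass_kernel (η := η) hF).comp
    (f := fun q : A × (E × E) => (q.1, q.2.1)) (by fun_prop)
  have h₂ := (measurable_colMass_kernel (κ := κ) hF).comp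
    (f := fun q : A × (E × E) => (q.1, q.2.2)) (by fun_prop)
  exact (hF.div (measurable_const.max h₁)).div (measurable_const.max h₂)

theorem measurable_fillDensity_kernel [IsSFiniteKernel κ] [IsSFiniteKernel η]
    {F : A → E × E → ℝ≥0∞} (hF : Measurable (Function.uncurry F)) :
    Measurable (Function.uncurry fun a => fillDensity (κ a) (η a) (F a)) := by
  have h₁ := (measurable_rowMass_kernel (η := η) hF).comp
    (f := fun q : A × (E × E) => (q.1, q.2.1)) (by fun_prop)
  have h₂ := (measurable_colMass_kernel (κ := κ) hF).comp
    (f := fun q : A × (E × E) => (q.1, q.2.2)) (by fun_prop)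
  have h₃ : Measurable fun a => ∫⁻ q, F a q ∂((κ a).prod (η a)) := by
    have := hF.lintegral_kernel_prod_right' (κ := κ ×ₖ η)
    simpa only [Kernel.prod_apply, Function.uncurry] using this
  have h₄ : Measurable fun q : A × (E × E) => ∫⁻ r, F q.1 r ∂((κ q.1).prod (η q.1)) :=
    h₃.comp measurable_fst
  exact hF.add ((measurable_const.sub h₁).mul
    ((measurable_const.sub h₂).div (measurable_const.sub h₄)))

/-- The couplings of `κ a` and `η a` that the density `F` is completed to. -/
noncomputable def densityKernel (κ η : Kernel A E) [IsSFiniteKernel κ] [IsSFiniteKernel η]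
    (F : E × E → ℝ≥0∞) : Kernel A (E × E) :=
  (κ ×ₖ η).withDensity fun a => fillDensity (κ a) (η a) (clipDensity (κ a) (η a) F)

theorem densityKernel_apply [IsSFiniteKernel κ] [IsSFiniteKernel η] {F : E × E → ℝ≥0∞}
    (hF : Measurable F) (a : A) :
    densityKernel κ η F a = ((κ a).prod (η a)).withDensity
      (fillDensity (κ a) (η a) (clipDensity (κ a) (η a) F)) := by
  rw [densityKernel, Kernel.withDensity_apply, Kernel.prod_apply]
  exact measurable_fillDensity_kernel
    (measurable_clipDensity_kernel (F := fun _ => F) (hF.comp measurable_snd))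

theorem densityKernel_mem_couplings [IsMarkovKernel κ] [IsMarkovKernel η] {F : E × E → ℝ≥0∞}
    (hF : Measurable F) (a : A) : densityKernel κ η F a ∈ couplings (κ a) (η a) := by
  rw [densityKernel_apply hF]
  exact withDensity_fillDensity_mem_couplings (measurable_clipDensity hF)
    (rowMass_clipDensity_le hF) (colMass_clipDensity_le hF)

end Selection

/-- The least index that works is a measurable function, because each condition on an index is
measurable. -/
theorem exists_measurable_le_iInf_add {A : Type*} [MeasurableSpace A] {c : ℕ → A → ℝ≥0∞}
    (hc : ∀ k, Measurable (c k)) {δ : ℝ≥0∞} (hδ : δ ≠ 0) :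
    ∃ k : A → ℕ, Measurable k ∧ ∀ a, c (k a) a ≤ (⨅ k, c k a) + δ := by
  classical
  have hi : Measurable fun a => ⨅ k, c k a := Measurable.iInf hc
  have hex : ∀ a, ∃ k, c k a ≤ (⨅ k, c k a) + δ := by
    intro a
    by_cases h : ⨅ k, c k a = ∞
    · exact ⟨0, by simp [h]⟩
    · obtain ⟨k, hk⟩ := iInf_lt_iff.1 (ENNReal.lt_add_right h hδ)
      exact ⟨k, hk.le⟩
  exact ⟨fun a => Nat.find (hex a),
    measurable_find hex fun k => measurableSet_le (hc k) (hi.add_const δ),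
    fun a => Nat.find_spec (hex a)⟩

section Selection

variable {A E : Type*} [MeasurableSpace A] [SeminormedAddCommGroup E] [MeasurableSpace E]
  [OpensMeasurableSpace E] [SecondCountableTopology E]

theorem measurable_densityCost (κ η : Kernel A E) [IsMarkovKernel κ] [IsMarkovKernel η]
    {F : E × E → ℝ≥0∞} (hF : Measurable F) :
    Measurable fun a => densityCost (κ a) (η a) F := by
  have : Measurable fun a => ∫⁻ p, edist p.1 p.2 ^ 2 ∂(densityKernel κ η F a) :=
    Measurable.lintegral_kernel (by fun_prop)
  simp only [densityKernel_apply hF] at this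
  exact this

/-- Supplies a measurable stand-in for `W2 ^ 2`, so that its integral can be transferred from a
marginal to a coupling. -/
theorem exists_measurable_eq_W2_sq (κ η : Kernel A E) [IsMarkovKernel κ] [IsMarkovKernel η] :
    ∃ c : A → ℝ≥0∞, Measurable c ∧ ∀ a, ∫⁻ x, ‖x‖ₑ ^ 2 ∂κ a ≠ ∞ →
      ∫⁻ x, ‖x‖ₑ ^ 2 ∂η a ≠ ∞ → W2 (κ a) (η a) ^ 2 = c a := by
  obtain ⟨F, hFm, hF⟩ := exists_densities_iInf_cost_eq E
  exact ⟨fun a => ⨅ k, densityCost (κ a) (η a) (F k),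
    Measurable.iInf fun k => measurable_densityCost κ η (hFm k),
    fun a hκ hη => (hF _ _ hκ hη).symm⟩

/-- Couplings of `κ a` and `η a` that are optimal up to `δ` can be chosen measurably in `a`. -/
theorem exists_near_optimal_kernel (κ η : Kernel A E) [IsMarkovKernel κ] [IsMarkovKernel η]
    {δ : ℝ≥0∞} (hδ : δ ≠ 0) :
    ∃ γ : Kernel A (E × E), (∀ a, γ a ∈ couplings (κ a) (η a)) ∧
      ∀ a, ∫⁻ x, ‖x‖ₑ ^ 2 ∂κ a ≠ ∞ → ∫⁻ x, ‖x‖ₑ ^ 2 ∂η a ≠ ∞ →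
        ∫⁻ p, edist p.1 p.2 ^ 2 ∂γ a ≤ W2 (κ a) (η a) ^ 2 + δ := by
  obtain ⟨F, hFm, hF⟩ := exists_densities_iInf_cost_eq E
  obtain ⟨k, hk, hle⟩ := exists_measurable_le_iInf_add
    (fun k => measurable_densityCost κ η (hFm k)) hδ
  have hm : Measurable fun q : ℕ × A => densityKernel κ η (F q.1) q.2 :=
    measurable_from_prod_countable_right fun k => (densityKernel κ η (F k)).measurable
  -- Index and parameter form one kernel, since the index set is countable; pulling it back along `a
  -- ↦ (k a, a)` makes the selection a kernel.
  let D : Kernel (ℕ × A) (E × E) := ⟨fun q => densityKernel κ η (F q.1) q.2, hm⟩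
  refine ⟨D.comap (fun a => (k a, a)) (hk.prodMk measurable_id), fun a => ?_, fun a hκ hη => ?_⟩
  · rw [Kernel.comap_apply]
    exact densityKernel_mem_couplings (hFm _) a
  · rw [← hF _ _ hκ hη]
    refine le_trans (le_of_eq ?_) (hle a)
    rw [Kernel.comap_apply, densityCost, ← densityKernel_apply (hFm _)]
    rfl

end Selection

/-! ### One conditioning step -/

theorem map_compProd_mem_couplings {A B C : Type*} [MeasurableSpace A] [MeasurableSpace B]
    [MeasurableSpace C]
    {θ ν : Measure A} [SFinite θ] [SFinite ν] {κ μ : Kernel A B} [IsSFiniteKernel κ]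
    [IsSFiniteKernel μ] {π : Measure (A × A)} [SFinite π] (hπ : π ∈ couplings θ ν)
    {γ : Kernel (A × A) (B × B)} [IsSFiniteKernel γ]
    (hγ : ∀ p, γ p ∈ couplings (κ p.1) (μ p.2)) {j : A × B → C} (hj : Measurable j) :
    (π ⊗ₘ γ).map (fun r => (j (r.1.1, r.2.1), j (r.1.2, r.2.2)))
      ∈ couplings ((θ ⊗ₘ κ).map j) ((ν ⊗ₘ μ).map j) := by
  have hm : Measurable fun r : (A × A) × (B × B) => (j (r.1.1, r.2.1), j (r.1.2, r.2.2)) := by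
    fun_prop
  constructor <;> refine Measure.ext_of_lintegral _ fun f hf => ?_
  · rw [lintegral_map hf measurable_fst, lintegral_map (by fun_prop) hm, lintegral_map hf hj,
      Measure.lintegral_compProd (by fun_prop), Measure.lintegral_compProd (by fun_prop),
      ← lintegral_fst_of_mem_couplings hπ
        (Measurable.lintegral_kernel_prod_right' (f := fun q => f (j q)) (by fun_prop)).aemeasurable]
    refine lintegral_congr fun p => ?_
    rw [← lintegral_fst_of_mem_couplings (hγ p) (by fun_prop)]
  · rw [lintegral_map hf measurable_snd, lintegral_map (by fun_prop) hm, lintegral_map hf hj,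
      Measure.lintegral_compProd (by fun_prop), Measure.lintegral_compProd (by fun_prop),
      ← lintegral_snd_of_mem_couplings hπ
        (Measurable.lintegral_kernel_prod_right' (f := fun q => f (j q)) (by fun_prop)).aemeasurable]
    refine lintegral_congr fun p => ?_
    rw [← lintegral_snd_of_mem_couplings (hγ p) (by fun_prop)]

theorem ae_lintegral_enorm_sq_ne_top {A E : Type*} [MeasurableSpace A]
    [SeminormedAddCommGroup E] [MeasurableSpace E] [OpensMeasurableSpace E] {θ : Measure A} [SFinite θ]
    {κ : Kernel A E} [IsSFiniteKernel κ] (h : ∫⁻ p, ‖p.2‖ₑ ^ 2 ∂(θ ⊗ₘ κ) ≠ ∞) :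
    ∀ᵐ a ∂θ, ∫⁻ x, ‖x‖ₑ ^ 2 ∂κ a ≠ ∞ := by
  rw [Measure.lintegral_compProd (by fun_prop)] at h
  have hm : Measurable fun a => ∫⁻ x, ‖x‖ₑ ^ 2 ∂κ a := Measurable.lintegral_kernel (by fun_prop)
  exact (ae_lt_top hm h).mono fun a ha => ha.ne

/-- All the `μ b` lie at finite distance from each other, so one infinite second moment makes all of
them infinite. Then `W2 (κ b) (μ b) = ∞` for almost every `b`, against the finite integral. -/
theorem lintegral_enorm_sq_ne_top_of_lipschitz {A E : Type*} [PseudoMetricSpace A] [MeasurableSpace A]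
    [SeminormedAddCommGroup E] [MeasurableSpace E] [OpensMeasurableSpace E]
    [SecondCountableTopology E] {θ : Measure A} [IsProbabilityMeasure θ]
    {κ μ : Kernel A E} (hκ : ∀ᵐ a ∂θ, ∫⁻ x, ‖x‖ₑ ^ 2 ∂κ a ≠ ∞) {K : ℝ≥0}
    (hε : ∫⁻ a, W2 (κ a) (μ a) ^ 2 ∂θ ≠ ∞)
    (hK : ∀ a b, W2 (μ a) (μ b) ≤ K * edist a b) (a : A) : ∫⁻ x, ‖x‖ₑ ^ 2 ∂μ a ≠ ∞ := by
  intro ha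
  have htop : ∀ b, ∫⁻ x, ‖x‖ₑ ^ 2 ∂μ b = ∞ := by
    intro b
    by_contra hb
    have h := lintegral_enorm_sq_le_W2 (μ b) (μ a)
    have hW : W2 (μ b) (μ a) ≠ ∞ := ((hK b a).trans_lt (by finiteness)).ne
    rw [ha, top_le_iff] at h
    exact ENNReal.add_ne_top.2 ⟨ENNReal.mul_ne_top (by simp) (ENNReal.pow_ne_top hW),
      ENNReal.mul_ne_top (by simp) hb⟩ h
  refine hε ?_
  rw [lintegral_congr_ae (g := fun _ => ∞)]
  · simp
  filter_upwards [hκ] with b hb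
  by_contra hW
  have h := lintegral_enorm_sq_le_W2 (κ b) (μ b)
  rw [htop b, top_le_iff] at h
  exact ENNReal.add_ne_top.2 ⟨ENNReal.mul_ne_top (by simp) hW, ENNReal.mul_ne_top (by simp) hb⟩ h

section Step

variable {E₁ E₂ F : Type*}
  [NormedAddCommGroup E₁] [MeasurableSpace E₁] [BorelSpace E₁] [SecondCountableTopology E₁]
  [NormedAddCommGroup E₂] [MeasurableSpace E₂] [BorelSpace E₂] [SecondCountableTopology E₂]
  [NormedAddCommGroup F] [MeasurableSpace F] [BorelSpace F] [SecondCountableTopology F]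

/-- If the transition laws `κ a` and `μ a` are close on average and `μ` is Lipschitz, then the
joint laws are close as soon as the initial laws are. -/
theorem W2_sq_map_compProd_le [StandardBorelSpace E₂] {θ ν : Measure E₁}
    [IsProbabilityMeasure θ] [IsProbabilityMeasure ν] {κ μ : Kernel E₁ E₂} [IsMarkovKernel κ]
    [IsMarkovKernel μ] {j : E₁ × E₂ → F} (hj : Measurable j)
    (hjd : ∀ p q, edist (j p) (j q) ^ 2 = edist p.1 q.1 ^ 2 + edist p.2 q.2 ^ 2)
    (hκ : ∀ᵐ a ∂θ, ∫⁻ x, ‖x‖ₑ ^ 2 ∂κ a ≠ ∞) (hμ : ∀ a, ∫⁻ x, ‖x‖ₑ ^ 2 ∂μ a ≠ ∞)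
    {ε : ℝ≥0∞} {K : ℝ≥0} (hε : ∫⁻ a, W2 (κ a) (μ a) ^ 2 ∂θ ≤ ε)
    (hK : ∀ a b, W2 (μ a) (μ b) ≤ K * edist a b) :
    W2 ((θ ⊗ₘ κ).map j) ((ν ⊗ₘ μ).map j) ^ 2
      ≤ (1 + 2 * (K : ℝ≥0∞) ^ 2) * W2 θ ν ^ 2 + 2 * ε := by
  refine le_mul_W2_sq_add (by simp) (by finiteness) fun π hπ => ?_
  have := isProbabilityMeasure_of_mem_couplings hπ
  refine ENNReal.le_of_forall_pos_le_add fun δ hδ _ => ?_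
  obtain ⟨c, hc, hcW⟩ := exists_measurable_eq_W2_sq κ μ
  -- The kernels are pulled back to pairs `(a, b)`, so that `γ` couples `κ a` with `μ b`.
  obtain ⟨γ, hγ, hγc⟩ := exists_near_optimal_kernel
    (κ.comap (Prod.fst : E₁ × E₁ → E₁) measurable_fst)
    (μ.comap (Prod.snd : E₁ × E₁ → E₁) measurable_snd)
    (ENNReal.coe_pos.2 hδ).ne'
  simp only [Kernel.comap_apply] at hγ hγc
  have : IsMarkovKernel γ := ⟨fun p => isProbabilityMeasure_of_mem_couplings (hγ p)⟩
  have hmem := map_compProd_mem_couplings hπ hγ hj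
  have hcε : ∫⁻ p, c p.1 ∂π ≤ ε := by
    rw [lintegral_fst_of_mem_couplings hπ hc.aemeasurable]
    refine le_trans (le_of_eq (lintegral_congr_ae ?_)) hε
    filter_upwards [hκ] with a ha using (hcW a ha (hμ a)).symm
  have hκπ : ∀ᵐ p ∂π, ∫⁻ x, ‖x‖ₑ ^ 2 ∂κ p.1 ≠ ∞ := by
    rw [← hπ.1] at hκ
    exact ae_of_ae_map (f := Prod.fst) measurable_fst.aemeasurable hκ
  refine (W2_sq_le hmem).trans ?_
  rw [lintegral_map (by fun_prop) (by fun_prop)]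
  simp only [hjd]
  rw [Measure.lintegral_compProd (by fun_prop)]
  calc _ ≤ ∫⁻ p, (1 + 2 * (K : ℝ≥0∞) ^ 2) * edist p.1 p.2 ^ 2 + (2 * c p.1 + δ) ∂π := by
        refine lintegral_mono_ae ?_
        filter_upwards [hκπ] with p hp
        rw [lintegral_add_left (by fun_prop)]
        simp only [lintegral_const, measure_univ, mul_one]
        calc _ ≤ edist p.1 p.2 ^ 2 + (2 * c p.1 + 2 * (K * edist p.1 p.2) ^ 2 + δ) := by
              gcongr
              refine (hγc p hp (hμ _)).trans ?_
              gcongr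
              -- The intermediate law is `μ a`: the closeness of `κ` and `μ` controls one leg and
              -- the Lipschitz bound on `μ` the other.
              refine (W2_sq_triangle _ (μ p.1) _).trans ?_
              rw [hcW _ hp (hμ _)]
              gcongr
              exact hK _ _
          _ = _ := by ring
    _ = (1 + 2 * (K : ℝ≥0∞) ^ 2) * ∫⁻ p, edist p.1 p.2 ^ 2 ∂π
        + (2 * ∫⁻ p, c p.1 ∂π + δ) := by
        rw [lintegral_add_left (by fun_prop), lintegral_add_left (by fun_prop),
          lintegral_const_mul _ (by fun_prop), lintegral_const_mul _ (by fun_prop)]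
        simp
    _ ≤ _ := by
        rw [← add_assoc]
        gcongr

/-- The Lipschitz bound compares `μ a` with `μ 0`, so the second moment of `μ a` grows at most
quadratically in `‖a‖`. -/
theorem isP2_map_compProd {ν : Measure E₁} (hν : IsP2 ν) {μ : Kernel E₁ E₂} [IsMarkovKernel μ]
    {j : E₁ × E₂ → F} (hj : Measurable j) (hj0 : j 0 = 0)
    (hjd : ∀ p q, edist (j p) (j q) ^ 2 = edist p.1 q.1 ^ 2 + edist p.2 q.2 ^ 2)
    (hμ : ∫⁻ x, ‖x‖ₑ ^ 2 ∂μ 0 ≠ ∞) {K : ℝ≥0}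
    (hK : ∀ a b, W2 (μ a) (μ b) ≤ K * edist a b) : IsP2 ((ν ⊗ₘ μ).map j) := by
  obtain ⟨_, hν⟩ := hν
  refine ⟨Measure.isProbabilityMeasure_map hj.aemeasurable, ?_⟩
  rw [lintegral_map (by fun_prop) hj]
  have hjn : ∀ p, ‖j p‖ₑ ^ 2 = ‖p.1‖ₑ ^ 2 + ‖p.2‖ₑ ^ 2 := fun p => by
    simpa [hj0] using hjd p 0
  simp only [hjn]
  rw [Measure.lintegral_compProd (by fun_prop)]
  calc _ ≤ ∫⁻ a, (‖a‖ₑ ^ 2 + (2 * K ^ 2 * ‖a‖ₑ ^ 2 + 2 * ∫⁻ x, ‖x‖ₑ ^ 2 ∂μ 0)) ∂ν := by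
        refine lintegral_mono fun a => ?_
        rw [lintegral_add_left (by fun_prop)]
        simp only [lintegral_const, measure_univ, mul_one]
        gcongr
        refine (lintegral_enorm_sq_le_W2 (μ 0) (μ a)).trans (add_le_add_left ?_ _)
        have : W2 (μ 0) (μ a) ≤ K * ‖a‖ₑ := by
          rw [← edist_zero_right, edist_comm]; exact hK 0 a
        calc _ ≤ 2 * (K * ‖a‖ₑ) ^ 2 := by gcongr
          _ = _ := by ring
    _ = ∫⁻ a, ‖a‖ₑ ^ 2 ∂ν + (2 * K ^ 2 * ∫⁻ a, ‖a‖ₑ ^ 2 ∂ν + 2 * ∫⁻ x, ‖x‖ₑ ^ 2 ∂μ 0) := by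
        rw [lintegral_add_left (by fun_prop), lintegral_add_left (by fun_prop),
          lintegral_const_mul _ (by fun_prop)]
        simp
    _ < ∞ := by finiteness

/-- One conditioning step. -/
theorem isP2_and_W2_sq_map_compProd_le [StandardBorelSpace E₂] {θ ν : Measure E₁}
    [IsProbabilityMeasure θ] (hν : IsP2 ν) {κ μ : Kernel E₁ E₂} [IsMarkovKernel κ]
    [IsMarkovKernel μ] {j : E₁ × E₂ → F} (hj : Measurable j) (hj0 : j 0 = 0)
    (hjd : ∀ p q, edist (j p) (j q) ^ 2 = edist p.1 q.1 ^ 2 + edist p.2 q.2 ^ 2)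
    (hκ : ∫⁻ p, ‖p.2‖ₑ ^ 2 ∂(θ ⊗ₘ κ) ≠ ∞)
    {ε K : ℝ≥0} (hε : ∫⁻ a, W2 (κ a) (μ a) ^ 2 ∂θ ≤ ε)
    (hK : ∀ a b, W2 (μ a) (μ b) ≤ K * edist a b) :
    IsP2 ((ν ⊗ₘ μ).map j) ∧ W2 ((θ ⊗ₘ κ).map j) ((ν ⊗ₘ μ).map j) ^ 2
      ≤ (1 + 20 * (K : ℝ≥0∞) ^ 2) * W2 θ ν ^ 2 + 4 * ε := by
  have hκ' := ae_lintegral_enorm_sq_ne_top hκ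
  have hμ := lintegral_enorm_sq_ne_top_of_lipschitz hκ' (hε.trans_lt ENNReal.coe_lt_top).ne hK
  have := hν.1
  refine ⟨isP2_map_compProd hν hj hj0 hjd (hμ 0) hK, ?_⟩
  refine (W2_sq_map_compProd_le hj hjd hκ' hμ hε hK).trans ?_
  -- The argument yields the constants 2 and 2, relaxed here to 20 and 4.
  gcongr <;> norm_num

end Step

/-! ### Euclidean products and random vectors -/

section RandomVectors

variable {d : ℕ}

theorem measurable_appendLast {k : ℕ} : Measurable (appendLast (d := d) (k := k)) := by
  refine (WithLp.measurable_toLp 2 _).comp (measurable_pi_lambda _ fun i => ?_)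
  refine Fin.lastCases ?_ (fun j => ?_) i
  · simp only [Fin.snoc_last]; fun_prop
  · simp only [Fin.snoc_castSucc]; fun_prop

theorem appendLast_zero {k : ℕ} : appendLast (0 : RnPow d k × Rn d) = 0 := by
  ext1 i
  refine Fin.lastCases ?_ (fun j => ?_) i <;> simp [appendLast]

theorem PiLp.edist_sq_eq_sum {ι : Type*} [Fintype ι] {E : ι → Type*}
    [∀ i, SeminormedAddCommGroup (E i)] (x y : PiLp 2 E) :
    edist x y ^ 2 = ∑ i, edist (x i) (y i) ^ 2 := by
  rw [PiLp.edist_eq_of_L2, ← ENNReal.rpow_natCast, ← ENNReal.rpow_mul]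
  norm_num

theorem WithLp.edist_sq_eq_add {E F : Type*} [SeminormedAddCommGroup E]
    [SeminormedAddCommGroup F] (x y : WithLp 2 (E × F)) :
    edist x y ^ 2 = edist x.fst y.fst ^ 2 + edist x.snd y.snd ^ 2 := by
  rw [WithLp.prod_edist_eq_of_L2, ← ENNReal.rpow_natCast, ← ENNReal.rpow_mul]
  norm_num

theorem edist_appendLast_sq {k : ℕ} (p q : RnPow d k × Rn d) :
    edist (appendLast p) (appendLast q) ^ 2 = edist p.1 q.1 ^ 2 + edist p.2 q.2 ^ 2 := by
  rw [PiLp.edist_sq_eq_sum, Fin.sum_univ_castSucc, PiLp.edist_sq_eq_sum p.1 q.1]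
  simp [appendLast]

theorem appendLast_initSeg {Ω : Type*} (X : ℕ → Ω → Rn d) (k : ℕ) (ω : Ω) :
    appendLast (initSeg X k ω, X k ω) = initSeg X (k + 1) ω := by
  ext1 i
  refine Fin.lastCases ?_ (fun j => ?_) i <;> simp [appendLast, initSeg]

variable {Ω : Type*} [MeasurableSpace Ω] {P : Measure Ω}

theorem aemeasurable_initSeg {X : ℕ → Ω → Rn d} {k : ℕ} (hX : ∀ i < k, AEMeasurable (X i) P) :
    AEMeasurable (initSeg X k) P :=
  (WithLp.measurable_toLp 2 _).comp_aemeasurable (aemeasurable_pi_lambda _ fun j => hX j j.2)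

theorem MeasureTheory.MemLp.lintegral_enorm_sq_lt_top {E : Type*} [NormedAddCommGroup E]
    {Y : Ω → E} (hY : MemLp Y 2 P) : ∫⁻ ω, ‖Y ω‖ₑ ^ 2 ∂P < ∞ := by
  have := (eLpNorm_lt_top_iff_lintegral_rpow_enorm_lt_top (by simp) (by simp)).1 hY.2
  simpa using this

theorem isP2_map {E : Type*} [NormedAddCommGroup E] [MeasurableSpace E] [BorelSpace E]
    [SecondCountableTopology E] [IsProbabilityMeasure P] {Y : Ω → E} (hY : MemLp Y 2 P) :
    IsP2 (P.map Y) := by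
  have hm := hY.1.aemeasurable
  refine ⟨Measure.isProbabilityMeasure_map hm, ?_⟩
  rw [lintegral_map' (by fun_prop) hm]
  exact hY.lintegral_enorm_sq_lt_top

theorem edist_toLp_const_sq (x y : Rn d) :
    edist (WithLp.toLp 2 fun _ : Fin 1 => x : RnPow d 1) (WithLp.toLp 2 fun _ : Fin 1 => y) ^ 2
      = edist x y ^ 2 := by
  rw [PiLp.edist_sq_eq_sum]
  simp

end RandomVectors

/-! ### The two estimates -/

theorem W2_sq_map_le {E F : Type*} [PseudoEMetricSpace E] [MeasurableSpace E]
    [PseudoEMetricSpace F] [MeasurableSpace F] [OpensMeasurableSpace F]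
    [SecondCountableTopology F] {j : E → F} (hj : Measurable j)
    (hjd : ∀ x y, edist (j x) (j y) ^ 2 = edist x y ^ 2) (μ ν : Measure E) :
    W2 (μ.map j) (ν.map j) ^ 2 ≤ W2 μ ν ^ 2 := by
  rw [W2_sq μ ν]
  refine le_iInf₂ fun π hπ => ?_
  have hJ : Measurable (Prod.map j j) := hj.prodMap hj
  have hmem : π.map (Prod.map j j) ∈ couplings (μ.map j) (ν.map j) := by
    rw [← hπ.1, ← hπ.2]
    constructor
    · rw [Measure.map_map measurable_fst hJ, Measure.map_map hj measurable_fst]; rfl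
    · rw [Measure.map_map measurable_snd hJ, Measure.map_map hj measurable_snd]; rfl
  refine (W2_sq_le hmem).trans_eq ?_
  rw [lintegral_map (by fun_prop) hJ]
  exact lintegral_congr fun p => hjd _ _

theorem isP2_toEuclid_compProd_and_W2_sq_le {m d : ℕ} {K ε : ℝ≥0} {ρ : Measure (Rn m × Rn d)}
    [IsProbabilityMeasure ρ] {ν : Measure (Rn m)} {μ : Kernel (Rn m) (Rn d)} [IsMarkovKernel μ]
    (hρ : IsP2 (toEuclid ρ)) (hν : IsP2 ν)
    (hε : ∫⁻ a, W2 (ρ.condKernel a) (μ a) ^ 2 ∂ρ.fst ≤ ε)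
    (hK : ∀ a b, W2 (μ a) (μ b) ≤ K * edist a b) :
    IsP2 (toEuclid (ν ⊗ₘ μ)) ∧
      W2 (toEuclid ρ) (toEuclid (ν ⊗ₘ μ)) ^ 2
        ≤ (1 + 20 * (K : ℝ≥0∞) ^ 2) * W2 ρ.fst ν ^ 2 + 4 * ε := by
  have hj : Measurable (WithLp.toLp 2 : Rn m × Rn d → WithLp 2 (Rn m × Rn d)) :=
    WithLp.measurable_toLp 2 _
  have hjd : ∀ p q : Rn m × Rn d, edist (WithLp.toLp 2 p) (WithLp.toLp 2 q) ^ 2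
      = edist p.1 q.1 ^ 2 + edist p.2 q.2 ^ 2 := fun p q => WithLp.edist_sq_eq_add _ _
  have hκ : ∫⁻ p, ‖p.2‖ₑ ^ 2 ∂(ρ.fst ⊗ₘ ρ.condKernel) ≠ ∞ := by
    rw [ρ.disintegrate ρ.condKernel]
    have h := hρ.2
    rw [toEuclid, lintegral_map (by fun_prop) hj] at h
    refine ((lintegral_mono fun p => ?_).trans_lt h).ne
    have := hjd p 0
    rw [WithLp.toLp_zero, edist_zero_right, Prod.snd_zero, edist_zero_right] at this
    rw [this]
    exact le_add_self
  have := isP2_and_W2_sq_map_compProd_le (θ := ρ.fst) hν hj (WithLp.toLp_zero 2) hjd hκ hε hK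
  rwa [ρ.disintegrate ρ.condKernel] at this

/-- With `L = 1 + 20K²`, one conditioning step gives the recursion `w (n + 1) ≤ L * w n + 4ε` for
the squared distances, which unrolls to the geometric sum. Conditioning on the whole past makes each
step an instance of the two-variable estimate. -/
theorem isP2_glue_and_W2_sq_le {d : ℕ} {K ε : ℝ≥0} {Ω : Type*} [MeasurableSpace Ω]
    {P : Measure Ω} [IsProbabilityMeasure P] {X : ℕ → Ω → Rn d} {Y₀ : Ω → Rn d}
    {μ : (i : ℕ) → Kernel (RnPow d (i + 1)) (Rn d)} [∀ i, IsMarkovKernel (μ i)] {n : ℕ}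
    (hX : ∀ i ≤ n, MemLp (X i) 2 P) (hY : MemLp Y₀ 2 P)
    (hε : ∀ i < n, ∫⁻ a, W2 (condDistrib (X (i + 1)) (initSeg X (i + 1)) P a) (μ i a) ^ 2
      ∂(P.map (initSeg X (i + 1))) ≤ ε)
    (hK : ∀ i < n, ∀ a b, W2 (μ i a) (μ i b) ≤ K * edist a b) :
    IsP2 (glue (P.map Y₀) μ n) ∧
      W2 (P.map (initSeg X (n + 1))) (glue (P.map Y₀) μ n) ^ 2
        ≤ 4 * ε * ∑ i ∈ Finset.range n, (1 + 20 * (K : ℝ≥0∞) ^ 2) ^ i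
          + (1 + 20 * (K : ℝ≥0∞) ^ 2) ^ n * W2 (P.map (X 0)) (P.map Y₀) ^ 2 := by
  induction n with
  | zero =>
    have hj : Measurable fun x : Rn d => (WithLp.toLp 2 fun _ : Fin 1 => x : RnPow d 1) :=
      (WithLp.measurable_toLp 2 _).comp (by fun_prop)
    have hYP := isP2_map hY
    have := hYP.1
    refine ⟨⟨Measure.isProbabilityMeasure_map hj.aemeasurable, ?_⟩, ?_⟩
    · rw [glue, lintegral_map (by fun_prop) hj]
      refine lt_of_eq_of_lt (lintegral_congr fun x => ?_) hYP.2
      have := edist_toLp_const_sq x 0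
      rw [edist_zero_right] at this
      rw [← this, ← edist_zero_right]
      rfl
    · have h0 : P.map (initSeg X (0 + 1))
          = (P.map (X 0)).map fun x => (WithLp.toLp 2 fun _ : Fin 1 => x : RnPow d 1) := by
        rw [AEMeasurable.map_map_of_aemeasurable hj.aemeasurable (hX 0 le_rfl).1.aemeasurable]
        congr 1
        funext ω
        ext1 i
        simp [initSeg]
      rw [h0, glue]
      simpa using W2_sq_map_le hj edist_toLp_const_sq (P.map (X 0)) (P.map Y₀)
  | succ n ih =>
    obtain ⟨hP2, hle⟩ := ih (fun i hi => hX i (by omega)) (fun i hi => hε i (by omega))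
      (fun i hi => hK i (by omega))
    have hXm : ∀ i ≤ n + 1, AEMeasurable (X i) P := fun i hi => (hX i hi).1.aemeasurable
    have hS : AEMeasurable (initSeg X (n + 1)) P :=
      aemeasurable_initSeg fun i hi => hXm i (by omega)
    have hSX := hS.prodMk (hXm (n + 1) le_rfl)
    have := Measure.isProbabilityMeasure_map hS
    have hjoint := compProd_map_condDistrib (mβ := inferInstance) (X := initSeg X (n + 1))
      (hXm (n + 1) le_rfl)
    have hκ : ∫⁻ p, ‖p.2‖ₑ ^ 2 ∂(P.map (initSeg X (n + 1)) ⊗ₘ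
        condDistrib (X (n + 1)) (initSeg X (n + 1)) P) ≠ ∞ := by
      rw [hjoint, lintegral_map' (by fun_prop) hSX]
      exact (hX (n + 1) le_rfl).lintegral_enorm_sq_lt_top.ne
    have hstep := isP2_and_W2_sq_map_compProd_le hP2 measurable_appendLast appendLast_zero
      edist_appendLast_sq hκ (hε n (by omega)) (hK n (by omega))
    rw [hjoint, AEMeasurable.map_map_of_aemeasurable measurable_appendLast.aemeasurable hSX]
      at hstep
    have hcomp : appendLast ∘ (fun ω => (initSeg X (n + 1) ω, X (n + 1) ω))
        = initSeg X (n + 1 + 1) := funext fun ω => appendLast_initSeg X (n + 1) ω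
    rw [hcomp] at hstep
    refine ⟨hstep.1, hstep.2.trans ?_⟩
    -- Splitting off the term with exponent 0 leaves a sum that is `L` times the previous one,
    -- matching the recursion.
    rw [Finset.sum_range_succ']
    calc _ ≤ (1 + 20 * (K : ℝ≥0∞) ^ 2)
          * (4 * ε * ∑ i ∈ Finset.range n, (1 + 20 * (K : ℝ≥0∞) ^ 2) ^ i
            + (1 + 20 * (K : ℝ≥0∞) ^ 2) ^ n * W2 (P.map (X 0)) (P.map Y₀) ^ 2) + 4 * ε := by
          gcongr
      _ = _ := by
          simp only [pow_succ _ _, ← Finset.sum_mul]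
          ring

theorem mainTheorem4 (K ε : ℝ≥0) :
    -- one conditioning step, for a joint law `ρ = P_{X_0, X_1}` and an initial law `ν = P_{Y_0}`
    (∀ (m d : ℕ) (ρ : Measure (Rn m × Rn d)) [IsProbabilityMeasure ρ]
        (ν : Measure (Rn m)) (μ : Kernel (Rn m) (Rn d)) [IsMarkovKernel μ],
      IsP2 (toEuclid ρ) → IsP2 ν →
      (∫⁻ a, W2 (ρ.condKernel a) (μ a) ^ 2 ∂ρ.fst ≤ ε) →
      (∀ᵐ a ∂ρ.fst, ∀ᵐ b ∂ρ.fst, W2 (ρ.condKernel a) (ρ.condKernel b) ≤ K * edist a b) →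
      (∀ a b, W2 (μ a) (μ b) ≤ K * edist a b) →
      IsP2 (toEuclid (ν ⊗ₘ μ)) ∧
      W2 (toEuclid ρ) (toEuclid (ν ⊗ₘ μ)) ^ 2
        ≤ (1 + 20 * (K : ℝ≥0∞) ^ 2) * W2 ρ.fst ν ^ 2 + 4 * ε) ∧
    -- several time points; only `X_0, …, X_n` and `μ_0, …, μ_{n-1}` matter
    (∀ (d n : ℕ) {Ω : Type*} [MeasurableSpace Ω] (P : Measure Ω) [IsProbabilityMeasure P]
        (X : ℕ → Ω → Rn d) (Y₀ : Ω → Rn d)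
        (μ : (i : ℕ) → Kernel (RnPow d (i + 1)) (Rn d)) [∀ i, IsMarkovKernel (μ i)],
      (∀ i ≤ n, MemLp (X i) 2 P) → MemLp Y₀ 2 P →
      (∀ i < n, ∫⁻ a, W2 (condDistrib (X (i + 1)) (initSeg X (i + 1)) P a) (μ i a) ^ 2
          ∂(P.map (initSeg X (i + 1))) ≤ ε) →
      (∀ i < n, ∀ᵐ a ∂(P.map (initSeg X (i + 1))), ∀ᵐ b ∂(P.map (initSeg X (i + 1))),
        W2 (condDistrib (X (i + 1)) (initSeg X (i + 1)) P a)
          (condDistrib (X (i + 1)) (initSeg X (i + 1)) P b) ≤ K * edist a b) →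
      (∀ i < n, ∀ a b, W2 (μ i a) (μ i b) ≤ K * edist a b) →
      IsP2 (glue (P.map Y₀) μ n) ∧
      W2 (P.map (initSeg X (n + 1))) (glue (P.map Y₀) μ n) ^ 2
        ≤ 4 * ε * ∑ i ∈ Finset.range n, (1 + 20 * (K : ℝ≥0∞) ^ 2) ^ i
          + (1 + 20 * (K : ℝ≥0∞) ^ 2) ^ n * W2 (P.map (X 0)) (P.map Y₀) ^ 2) :=
  ⟨fun _ _ _ _ _ _ _ hρ hν hε _ hK => isP2_toEuclid_compProd_and_W2_sq_le hρ hν hε hK,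
    fun _ _ _ _ _ _ _ _ _ _ hX hY hε _ hK => isP2_glue_and_W2_sq_le hX hY hε hK⟩
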